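/- **Decision problems.** A decision problem consists of a parameter $\theta\in\Theta$ with a prior distribution $\mathbf P$, an observation space $S$, a compact metric action space $A$, a jointly measurable reward $u:\Theta\times A\to\mathbb R$ that is continuous in $a$ and such that $\theta\mapsto\max_a u(\theta,a)$ and $\theta\mapsto\min_a u(\theta,a)$ have finite expectation, and, for every stage $n\ge 1$, a transition probability from $\Theta\times(S\times A)^{n-1}$ to $S$ according to which the observation of stage $n$ is drawn. At each stage the decision maker gets the observation and then chooses an action. A decision rule $\sigma$ is a sequence of measurable maps $\sigma_n:(S\times A)^{n-1}\times S\to A$. Let $\mathbf P_\sigma$ be the induced law of $\theta$ and of the sequence of observations and actions $(s_n,a_n)$, and let $\mathcal H_n$ be the information available when $a_n$ is chosen, i.e. the $\sigma$-field generated by $s_1,a_1,\dots,s_{n-1},a_{n-1},s_n$. For a discount factor $\delta$, the rule $\sigma$ is optimal if it maximizes $\mathbf E_\sigma[(1-\delta)\sum_{n\ge1}\delta^{n-1}u(\theta,a_n)]$ over all decision rules. The amount of experimentation at stage $n$ is $$\Delta_n=\max_{a\in A}\mathbf E_\sigma[u(\theta,a)\mid\mathcal H_n]-\mathbf E_\sigma[u(\theta,a_n)\mid\mathcal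 H_n],$$ where the conditional expectations are taken through the conditional law of $\theta$ given $\mathcal H_n$; for $\varepsilon>0$ let $N(\varepsilon)=|\{n\ge1:\Delta_n\ge\varepsilon\}|$. **Proposition.** There is a single decision problem (not depending on $\delta$) such that for every $\delta\in(2/3,1)$ there is an optimal decision rule $\sigma$ that is unique, in the sense that every optimal decision rule $\tau$ prescribes, $\mathbf P_\sigma$-almost surely, the same action as $\sigma$ at every stage, and this rule satisfies $$\lim_{\varepsilon\to0^+}\varepsilon^\alpha\,\mathbf E_\sigma[N(\varepsilon)]=+\infty\quad\text{for every }\alpha<1.$$ Moreover the decision problem can be chosen to be Gaussian, as follows: $\Theta=\mathbb R$ and the prior is a non-degenerate normal distribution; $A=\mathbb R\cup\{-\infty,+\infty\}$; and there are a decision rule $(\hat a_n)_{n\ge1}$ (the prescribed sequence of actions, each depending on the past) and variances $v_n>0$ such that nothing is observed at stage $1$, while at a stage $n\ge2$ the decision maker observes $\theta+\xi_n$, where $\xi_n$ is an independent centred normal variable with variance $v_n$, if she has played as $(\hat a_n)$ prescribes at all previous stages, and observes nothing otherwise. The prescribed actions are suboptimal: when they are followed, $\Delta_n>0$ almost surely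 for every $n$. -/

import Mathlib

open MeasureTheory ProbabilityTheory Filter Topology
open scoped ENNReal NNReal

noncomputable section

universe u

/-- A (discounted, Bayesian) decision problem without its discount factor. The parameter is drawn
from `prior`. At every stage `n = 0, 1, 2, …` the decision maker first gets an observation in `S`,
drawn from a transition probability that may depend on the parameter and on all past observations
and actions, then chooses an action in the compact metric space `A` and gets the reward
`reward θ a`. The stages are numbered from `0`. -/
structure DecisionProblem (Θ S A : Type u) [MeasurableSpace Θ] [MeasurableSpace S]
    [TopologicalSpace A] [CompactSpace A] [TopologicalSpace.MetrizableSpace A] [Nonempty A]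
    [MeasurableSpace A] [BorelSpace A] where
  /-- the prior distribution of the parameter -/
  prior : Measure Θ
  isProbabilityMeasure_prior : IsProbabilityMeasure prior
  /-- the law of the observation of stage `n`, given the parameter and the past -/
  obs : ∀ n : ℕ, Kernel (Θ × (Fin n → S × A)) S
  isMarkovKernel_obs : ∀ n, IsMarkovKernel (obs n)
  /-- the reward function -/
  reward : Θ → A → ℝ
  measurable_reward : Measurable (Function.uncurry reward)
  continuous_reward : ∀ θ, Continuous (reward θ)
  integrable_highest : Integrable (fun θ => ⨆ a, reward θ a) prior
  integrable_lowest : Integrable (fun θ => ⨅ a, reward θ a) prior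

attribute [instance] DecisionProblem.isProbabilityMeasure_prior
  DecisionProblem.isMarkovKernel_obs

/-- What the decision maker knows when choosing the action of stage `n`: the observations and
actions of the stages before `n`, and the observation of stage `n`. -/
abbrev Info (S A : Type u) (n : ℕ) : Type u := (Fin n → S × A) × S

/-- A decision rule: a measurable choice of the action of stage `n` as a function of the
information available at that stage, for each `n`. -/
structure DecisionRule (S A : Type u) [MeasurableSpace S] [MeasurableSpace A] where
  /-- the action chosen at stage `n` -/
  act : ∀ n : ℕ, Info S A n → A
  measurable_act : ∀ n, Measurable (act n)

/-- A play: the parameter and the infinite sequence of observations and actions. -/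
abbrev Play (Θ S A : Type u) : Type u := Θ × (ℕ → S × A)

/-- The information available at stage `n` along a play. -/
def Play.info {Θ S A : Type u} (ω : Play Θ S A) (n : ℕ) : Info S A n :=
  (fun i => ω.2 i, (ω.2 n).1)

/-- The coordinates of a play in the order in which they are drawn: first the parameter, then the
pairs (observation, action). -/
def Coord (Θ S A : Type u) : ℕ → Type u
  | 0 => Θ
  | _ + 1 => S × A

instance Coord.measurableSpace {Θ S A : Type u} [MeasurableSpace Θ] [MeasurableSpace S]
    [MeasurableSpace A] : ∀ n, MeasurableSpace (Coord Θ S A n)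
  | 0 => inferInstanceAs (MeasurableSpace Θ)
  | _ + 1 => inferInstanceAs (MeasurableSpace (S × A))

/-- The parameter and the history of the stages before `n`, read off the first `n + 1`
coordinates. -/
def Coord.past {Θ S A : Type u} (n : ℕ) (x : (i : Finset.Iic n) → Coord Θ S A i) :
    Θ × (Fin n → S × A) :=
  (x ⟨0, Finset.mem_Iic.2 (Nat.zero_le n)⟩,
    fun i => x ⟨(i : ℕ) + 1, Finset.mem_Iic.2 (Nat.succ_le_of_lt i.isLt)⟩)

theorem Coord.measurable_past {Θ S A : Type u} [MeasurableSpace Θ] [MeasurableSpace S]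
    [MeasurableSpace A] (n : ℕ) : Measurable (Coord.past (Θ := Θ) (S := S) (A := A) n) := by
  refine Measurable.prodMk ?_ (measurable_pi_lambda _ fun i => ?_)
  · exact measurable_pi_apply (X := fun i : Finset.Iic n => Coord Θ S A i)
      ⟨0, Finset.mem_Iic.2 (Nat.zero_le n)⟩
  · exact measurable_pi_apply (X := fun i : Finset.Iic n => Coord Θ S A i)
      ⟨(i : ℕ) + 1, Finset.mem_Iic.2 (Nat.succ_le_of_lt i.isLt)⟩

/-- The sequence of coordinates, seen as a play. -/
def Coord.toPlay {Θ S A : Type u} (x : (n : ℕ) → Coord Θ S A n) : Play Θ S A :=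
  (x 0, fun n => x (n + 1))

theorem Coord.measurable_toPlay {Θ S A : Type u} [MeasurableSpace Θ] [MeasurableSpace S]
    [MeasurableSpace A] : Measurable (Coord.toPlay (Θ := Θ) (S := S) (A := A)) :=
  (measurable_pi_apply (X := Coord Θ S A) 0).prodMk
    (measurable_pi_lambda _ fun n => measurable_pi_apply (X := Coord Θ S A) (n + 1))

theorem DecisionRule.measurable_stage {Θ S A : Type u} [MeasurableSpace Θ] [MeasurableSpace S]
    [MeasurableSpace A] (σ : DecisionRule S A) (n : ℕ) :
    Measurable (fun p : (Θ × (Fin n → S × A)) × S => (p.2, σ.act n (p.1.2, p.2))) :=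
  measurable_snd.prodMk ((σ.measurable_act n).comp
    ((measurable_snd.comp measurable_fst).prodMk measurable_snd))

namespace DecisionProblem

variable {Θ S A : Type u} [MeasurableSpace Θ] [MeasurableSpace S]
  [TopologicalSpace A] [CompactSpace A] [TopologicalSpace.MetrizableSpace A] [Nonempty A]
  [MeasurableSpace A] [BorelSpace A]

/-- Given the parameter and the history of the stages before `n`, draw the observation of stage
`n`, then play the action that `σ` prescribes. -/
def stageKernel (D : DecisionProblem Θ S A) (σ : DecisionRule S A) (n : ℕ) :
    Kernel (Θ × (Fin n → S × A)) (S × A) :=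
  (Kernel.id ×ₖ D.obs n).map (fun p => (p.2, σ.act n (p.1.2, p.2)))

instance isMarkovKernel_stageKernel (D : DecisionProblem Θ S A) (σ : DecisionRule S A) (n : ℕ) :
    IsMarkovKernel (D.stageKernel σ n) :=
  Kernel.IsMarkovKernel.map _ (σ.measurable_stage n)

/-- The transition probability from the first `n + 1` coordinates of a play to the next one. -/
def coordKernel (D : DecisionProblem Θ S A) (σ : DecisionRule S A) (n : ℕ) :
    Kernel ((i : Finset.Iic n) → Coord Θ S A i) (Coord Θ S A (n + 1)) :=
  (D.stageKernel σ n).comap (Coord.past n) (Coord.measurable_past n)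

instance isMarkovKernel_coordKernel (D : DecisionProblem Θ S A) (σ : DecisionRule S A) (n : ℕ) :
    IsMarkovKernel (D.coordKernel σ n) :=
  inferInstanceAs
    (IsMarkovKernel ((D.stageKernel σ n).comap (Coord.past n) (Coord.measurable_past n)))

/-- The prior, as a measure on the first coordinate. -/
def coordPrior (D : DecisionProblem Θ S A) : Measure (Coord Θ S A 0) := D.prior

instance isProbabilityMeasure_coordPrior (D : DecisionProblem Θ S A) :
    IsProbabilityMeasure D.coordPrior := D.isProbabilityMeasure_prior

/-- The joint distribution `P_σ` of the parameter and of the infinite sequence of observations and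
actions, when the decision rule `σ` is used (Ionescu-Tulcea). -/
def law (D : DecisionProblem Θ S A) (σ : DecisionRule S A) : Measure (Play Θ S A) :=
  (Kernel.trajMeasure D.coordPrior (D.coordKernel σ)).map Coord.toPlay

instance isProbabilityMeasure_law (D : DecisionProblem Θ S A) (σ : DecisionRule S A) :
    IsProbabilityMeasure (D.law σ) :=
  Measure.isProbabilityMeasure_map Coord.measurable_toPlay.aemeasurable

/-- The expected (normalized) discounted reward of the decision rule `σ`. -/
def payoff (D : DecisionProblem Θ S A) (δ : ℝ) (σ : DecisionRule S A) : ℝ :=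
  ∫ ω, (1 - δ) * ∑' n, δ ^ n * D.reward ω.1 (ω.2 n).2 ∂(D.law σ)

/-- `σ` is optimal when the discount factor is `δ`. -/
def IsOptimal (D : DecisionProblem Θ S A) (δ : ℝ) (σ : DecisionRule S A) : Prop :=
  ∀ τ : DecisionRule S A, D.payoff δ τ ≤ D.payoff δ σ

/-- Along almost every play of `σ`, the rules `σ` and `τ` prescribe the same action at every
stage; thus `τ` differs from `σ` only at histories that almost surely do not occur. -/
def PlaysAs (D : DecisionProblem Θ S A) (τ σ : DecisionRule S A) : Prop :=
  ∀ᵐ ω ∂(D.law σ), ∀ n, τ.act n (ω.info n) = σ.act n (ω.info n)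

section Experimentation

variable [StandardBorelSpace Θ] [Nonempty Θ]

/-- The posterior distribution of the parameter given the information available at stage `n`. -/
def posterior (D : DecisionProblem Θ S A) (σ : DecisionRule S A) (n : ℕ) :
    Kernel (Info S A n) Θ :=
  condDistrib (fun ω : Play Θ S A => ω.1) (fun ω => ω.info n) (D.law σ)

/-- The expected reward `E_σ[u(θ, a) | H_n]` of the action `a`, given the information available at
stage `n`. -/
def expReward (D : DecisionProblem Θ S A) (σ : DecisionRule S A) (n : ℕ) (ω : Play Θ S A)
    (a : A) : ℝ :=
  ∫ θ, D.reward θ a ∂(D.posterior σ n (ω.info n))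

/-- The amount of experimentation at stage `n`: the myopically optimal expected reward, minus the
expected reward of the action that is played. -/
def experimentation (D : DecisionProblem Θ S A) (σ : DecisionRule S A) (n : ℕ)
    (ω : Play Θ S A) : ℝ :=
  (⨆ a, D.expReward σ n ω a) - D.expReward σ n ω (ω.2 n).2

/-- The number of stages at which the amount of experimentation is at least `ε`. -/
def numExperiments (D : DecisionProblem Θ S A) (σ : DecisionRule S A) (ε : ℝ)
    (ω : Play Θ S A) : ℕ∞ :=
  {n : ℕ | ε ≤ D.experimentation σ n ω}.encard

/-- The expected number of stages at which the amount of experimentation is at least `ε`. -/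
def expectedNumExperiments (D : DecisionProblem Θ S A) (σ : DecisionRule S A) (ε : ℝ) : ℝ≥0∞ :=
  ∫⁻ ω, (D.numExperiments σ ε ω : ℝ≥0∞) ∂(D.law σ)

end Experimentation

end DecisionProblem

/-- In the history `h` of the stages before `n`, all actions are those that `a` prescribes. -/
def DecisionRule.Follows {S A : Type u} [MeasurableSpace S] [MeasurableSpace A]
    (a : DecisionRule S A) {n : ℕ} (h : Fin n → S × A) : Prop :=
  ∀ k : Fin n, (h k).2 = a.act k (fun i => h (Fin.castLE k.isLt.le i), (h k).1)

open Classical in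
/-- The parameter is real and its prior is normal, the actions are the extended reals, and the
observations are as follows (`Sum.inl ()` means that nothing is observed). At the initial stage
nothing is observed. At a later stage `n`, the parameter plus an independent centred normal noise
with variance `v n` is observed if all actions so far are those that `a` prescribes; otherwise
nothing is observed. -/
structure IsGaussianProblem (D : DecisionProblem ℝ (Unit ⊕ ℝ) EReal)
    (a : DecisionRule (Unit ⊕ ℝ) EReal) (v : ℕ → ℝ≥0) : Prop where
  prior_eq : ∃ (m : ℝ) (w : ℝ≥0), w ≠ 0 ∧ D.prior = gaussianReal m w
  noise_ne_zero : ∀ n, v n ≠ 0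
  obs_eq : ∀ (n : ℕ) (θ : ℝ) (h : Fin n → (Unit ⊕ ℝ) × EReal),
    D.obs n (θ, h) =
      if n ≠ 0 ∧ a.Follows h then (gaussianReal θ (v n)).map Sum.inr
      else Measure.dirac (Sum.inl ())

end

/-!
The decision maker has to guess the parameter modulo `2π`: the actions are wound around the circle
and the reward is `cos (θ - angle a)`. When the posterior distribution is `N(m, w)`, the expected
reward of `a` is `exp (-w / 2) * cos (m - angle a)` (`integral_cos_sub_gaussianReal`). So the
highest expected reward `exp (-w / 2)` depends on the variance only, and the prescribed actions can
give up exactly a deterministic amount `cost n`, by a deterministic angle `tilt n` between the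
action and the posterior mean.

The variances of the noise are such that the highest expected reward after `n` informative
observations is `value n = 1 / 2 - 1 / (4 log (n + 3))`, and `cost n` is twice the increment
`value (n + 1) - value n`. To play as prescribed forever is optimal: whoever deviates at stage `k`
gets no more observations, thus at most `value k` at each later stage, and if
`x n = value n - value k` for `n ≥ k` then the sum of `δ ^ n * (x n - cost n)` over `n ≥ k` is
`3 - 2 / δ` times that of `δ ^ n * x n`, because `x k = 0`. This is positive for `δ > 2 / 3`
(`discounted_stop_lt`). The loss being strict on each play that deviates, an optimal rule almost
surely does not deviate, so that it has the same law as the prescribed one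
(`DecisionProblem.lintegral_law_hist_congr`).

The costs are at least of the order of `1 / (n log² n)`, hence more than about `ε ^ (-γ)` of them
exceed `ε`, for each `γ < 1` (`tendsto_rpow_mul_encard_cost`).

To compare with an arbitrary rule one needs the conditional law of the parameter under that rule. It
is the same kernel `postKernel` for all rules (`map_law_eq_compProd`), by induction on the stage:
actions carry no information, and observations are dealt with by Bayes' rule for normal laws.
-/

noncomputable section

universe u

/-! ### The circle of actions -/

/-- The extended real line, wound once around the circle: an increasing homeomorphism of `EReal`
with `[0, 2π]`, followed by the inclusion in the reals. -/
def angle (a : EReal) : ℝ :=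
  2 * Real.pi * (ENNReal.orderIsoUnitIntervalBirational (EReal.expOrderIso a) : ℝ)

/-- The action whose angle is `x` modulo `2π`. -/
def ofAngle (x : ℝ) : EReal :=
  EReal.expOrderIso.symm (ENNReal.orderIsoUnitIntervalBirational.symm
    ⟨Int.fract (x / (2 * Real.pi)), Int.fract_nonneg _, (Int.fract_lt_one _).le⟩)

theorem continuous_angle : Continuous angle :=
  continuous_const.mul (continuous_subtype_val.comp
    (ENNReal.orderIsoUnitIntervalBirational.continuous.comp EReal.expOrderIso.continuous))

theorem measurable_ofAngle : Measurable ofAngle :=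
  EReal.expOrderIso.symm.continuous.measurable.comp
    (ENNReal.orderIsoUnitIntervalBirational.symm.continuous.measurable.comp
      ((measurable_fract.comp (measurable_id.div_const _)).subtype_mk))

theorem cos_sub_angle_ofAngle (y x : ℝ) : Real.cos (y - angle (ofAngle x)) = Real.cos (y - x) := by
  have h : angle (ofAngle x) = x - ⌊x / (2 * Real.pi)⌋ * (2 * Real.pi) := by
    have := Real.pi_pos
    simp only [angle, ofAngle, OrderIso.apply_symm_apply, Int.fract]
    field_simp
  rw [h, ← Real.cos_add_int_mul_two_pi (y - x) ⌊x / (2 * Real.pi)⌋]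
  ring_nf

/-! ### Gaussian computations -/

theorem integral_cos_sub_gaussianReal (m : ℝ) (w : ℝ≥0) (t : ℝ) :
    ∫ θ, Real.cos (θ - t) ∂(gaussianReal m w) = Real.exp (-(w : ℝ) / 2) * Real.cos (m - t) := by
  have h := charFun_gaussianReal (μ := m) (v := w) 1
  rw [charFun_apply_real] at h
  have hint : Integrable (fun θ : ℝ => Complex.exp (((θ - t : ℝ) : ℂ) * Complex.I))
      (gaussianReal m w) := by
    refine Integrable.of_bound (by fun_prop) 1 (ae_of_all _ fun θ => ?_)
    rw [Complex.norm_exp_ofReal_mul_I]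
  have h1 : ∫ θ, Complex.exp (((θ - t : ℝ) : ℂ) * Complex.I) ∂(gaussianReal m w)
      = Complex.exp (((-(w : ℝ) / 2 : ℝ) : ℂ) + ((m - t : ℝ) : ℂ) * Complex.I) := by
    have h2 : ∀ θ : ℝ, Complex.exp (((θ - t : ℝ) : ℂ) * Complex.I)
        = Complex.exp (-(t : ℂ) * Complex.I) * Complex.exp (((1 : ℝ) : ℂ) * θ * Complex.I) := by
      intro θ
      rw [← Complex.exp_add]
      push_cast
      ring_nf
    simp_rw [h2]
    rw [integral_const_mul, h, ← Complex.exp_add]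
    push_cast
    ring_nf
  have h3 := congrArg Complex.re h1
  rw [← RCLike.re_eq_complex_re, ← integral_re hint] at h3
  simpa [Complex.exp_re, RCLike.re_eq_complex_re] using h3

/-- Bayes' rule for a normal prior with mean `m` and variance `w`, and a normal observation with
variance `v`: the two factorizations of the joint density. -/
theorem gaussianPDF_mul_gaussianPDF (m θ y : ℝ) {w v w' : ℝ≥0} (hw : w ≠ 0) (hv : v ≠ 0)
    (hw' : w' = w * v / (w + v)) :
    gaussianPDF m w θ * gaussianPDF θ v y
      = gaussianPDF m (w + v) y * gaussianPDF (m + w / (w + v) * (y - m)) w' θ := by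
  have hw0 : (0 : ℝ) < w := by positivity
  have hv0 : (0 : ℝ) < v := by positivity
  have hpi := Real.pi_pos
  simp only [gaussianPDF]
  rw [← ENNReal.ofReal_mul (gaussianPDFReal_nonneg _ _ _),
    ← ENNReal.ofReal_mul (gaussianPDFReal_nonneg _ _ _)]
  congr 1
  subst hw'
  simp only [gaussianPDFReal, NNReal.coe_add, NNReal.coe_mul, NNReal.coe_div]
  rw [mul_mul_mul_comm, mul_mul_mul_comm (√(2 * Real.pi * (w + v)))⁻¹, ← Real.exp_add,
    ← Real.exp_add, ← mul_inv, ← mul_inv, ← Real.sqrt_mul (by positivity),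
    ← Real.sqrt_mul (by positivity)]
  congr 2
  · congr 1
    field_simp
  · field_simp
    ring

/-- Bayes' rule: when the observation `y` is drawn from `N(θ, v)` and `θ` from `N(m, w)`, redrawing
`θ` from its posterior distribution given `y` does not change the joint law of `θ` and `y`. -/
theorem lintegral_gaussianReal_bayes (m : ℝ) {w v w' : ℝ≥0} (hw : w ≠ 0) (hv : v ≠ 0)
    (hw' : w' = w * v / (w + v)) {f : ℝ → ℝ → ℝ≥0∞} (hf : Measurable (Function.uncurry f)) :
    ∫⁻ θ, ∫⁻ y, f y θ ∂(gaussianReal θ v) ∂(gaussianReal m w)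
      = ∫⁻ θ, ∫⁻ y, ∫⁻ θ', f y θ' ∂(gaussianReal (m + w / (w + v) * (y - m)) w')
          ∂(gaussianReal θ v) ∂(gaussianReal m w) := by
  have hw'0 : w' ≠ 0 := by
    rw [hw']; positivity
  have hm : ∀ {g : ℝ → ℝ → ℝ≥0∞}, Measurable (Function.uncurry g) →
      ∫⁻ θ, ∫⁻ y, g y θ ∂(gaussianReal θ v) ∂(gaussianReal m w)
        = ∫⁻ y, gaussianPDF m (w + v) y *
            ∫⁻ θ, g y θ ∂(gaussianReal (m + w / (w + v) * (y - m)) w') := by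
    intro g hg
    have hgm : ∀ θ, Measurable fun y => g y θ := fun θ => hg.comp measurable_prodMk_right
    have hgm' : ∀ y, Measurable (g y) := fun y => hg.comp measurable_prodMk_left
    have hpdf : Measurable fun p : ℝ × ℝ => gaussianPDF p.1 v p.2 := by
      unfold gaussianPDF gaussianPDFReal
      fun_prop
    have hin : ∀ θ, ∫⁻ y, g y θ ∂(gaussianReal θ v) = ∫⁻ y, gaussianPDF θ v y * g y θ := by
      intro θ
      rw [gaussianReal_of_var_ne_zero _ hv,
        lintegral_withDensity_eq_lintegral_mul _ (measurable_gaussianPDF _ _) (hgm θ)]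
      rfl
    have hout : Measurable fun θ => ∫⁻ y, gaussianPDF θ v y * g y θ :=
      Measurable.lintegral_prod_right' (f := fun p : ℝ × ℝ => gaussianPDF p.1 v p.2 * g p.2 p.1)
        (hpdf.mul (hg.comp measurable_swap))
    simp_rw [hin]
    rw [gaussianReal_of_var_ne_zero _ hw,
      lintegral_withDensity_eq_lintegral_mul _ (measurable_gaussianPDF _ _) hout]
    simp only [Pi.mul_apply]
    have h1 : ∀ θ, gaussianPDF m w θ * ∫⁻ y, gaussianPDF θ v y * g y θ
        = ∫⁻ y, gaussianPDF m (w + v) y *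
            (gaussianPDF (m + w / (w + v) * (y - m)) w' θ * g y θ) := by
      intro θ
      have : Measurable fun y => gaussianPDF θ v y * g y θ :=
        (measurable_gaussianPDF _ _).mul (hgm θ)
      rw [← lintegral_const_mul _ this]
      refine lintegral_congr fun y => ?_
      rw [← mul_assoc, gaussianPDF_mul_gaussianPDF m θ y hw hv hw', mul_assoc]
    simp_rw [h1]
    have hpdf' : Measurable fun p : ℝ × ℝ =>
        gaussianPDF (m + w / (w + v) * (p.2 - m)) w' p.1 := by
      unfold gaussianPDF gaussianPDFReal
      fun_prop
    rw [lintegral_lintegral_swap]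
    · refine lintegral_congr fun y => ?_
      have : Measurable fun θ => gaussianPDF (m + w / (w + v) * (y - m)) w' θ * g y θ :=
        (measurable_gaussianPDF _ _).mul (hgm' y)
      rw [lintegral_const_mul _ this,
        gaussianReal_of_var_ne_zero _ hw'0,
        lintegral_withDensity_eq_lintegral_mul _ (measurable_gaussianPDF _ _) (hgm' y)]
      rfl
    · exact ((((measurable_gaussianPDF _ _).comp measurable_snd).mul
        (hpdf'.mul (hg.comp measurable_swap)))).aemeasurable
  rw [hm hf]
  have hk : Measurable fun p : ℝ × ℝ =>
      ∫⁻ θ', f p.1 θ' ∂(gaussianReal (m + w / (w + v) * (p.1 - m)) w') := by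
    let κ : Kernel ℝ ℝ := ⟨fun y => gaussianReal (m + w / (w + v) * (y - m)) w', by
      have : Measurable fun y : ℝ => ((m + w / (w + v) * (y - m) : ℝ), w') := by fun_prop
      exact measurable_gaussianReal.comp this⟩
    have : IsMarkovKernel κ :=
      ⟨fun y => inferInstanceAs (IsProbabilityMeasure (gaussianReal _ _))⟩
    exact (Measurable.lintegral_kernel_prod_right (κ := κ) hf).comp measurable_fst
  rw [hm (g := fun y _ => ∫⁻ θ', f y θ' ∂(gaussianReal (m + w / (w + v) * (y - m)) w')) hk]
  simp

/-! ### The values, the variances and the costs -/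

/-- The highest expected reward at stage `n`, when the stages before `n` have been played as
prescribed. It increases by about `1 / (4 n log² n)`, barely a summable amount. -/
def value (n : ℕ) : ℝ := 1 / 2 - 1 / (4 * Real.log (n + 3))

/-- What the prescribed action of stage `n` gives up: twice the value of the information that it
buys. The factor `2` is `δ / (1 - δ)` at the threshold `δ = 2 / 3`. -/
def cost (n : ℕ) : ℝ := 2 * (value (n + 1) - value n)

/-- The posterior variance at stage `n`, when the stages before `n` have been played as
prescribed. -/
def postVar (n : ℕ) : ℝ≥0 := (-2 * Real.log (value n)).toNNReal

/-- The variance of the noise of the observation of stage `n`, chosen such that the posterior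
variance decreases from `postVar (n - 1)` to `postVar n`. Nothing is observed at the initial
stage. -/
def noise : ℕ → ℝ≥0
  | 0 => 1
  | n + 1 => postVar n * postVar (n + 1) / (postVar n - postVar (n + 1))

/-- The angle between the prescribed action of stage `n` and the posterior mean. -/
def tilt (n : ℕ) : ℝ := Real.arccos (1 - cost n / value n)

theorem one_lt_log_add_three (n : ℕ) : 1 < Real.log (n + 3) := by
  rw [Real.lt_log_iff_exp_lt (by positivity)]
  have := Real.exp_one_lt_d9
  have : (0 : ℝ) ≤ n := by positivity
  linarith

theorem strictMono_value : StrictMono value := by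
  refine strictMono_nat_of_lt_succ fun n => ?_
  have h := one_lt_log_add_three n
  have h2 : Real.log (n + 3) < Real.log ((n + 1 : ℕ) + 3) :=
    Real.log_lt_log (by positivity) (by push_cast; linarith)
  have := one_div_lt_one_div_of_lt (a := 4 * Real.log (n + 3)) (by linarith)
    (show _ < 4 * Real.log ((n + 1 : ℕ) + 3) by linarith)
  simp only [value]
  linarith

theorem quarter_lt_value (n : ℕ) : 1 / 4 < value n := by
  have h := one_lt_log_add_three n
  have := one_div_lt_one_div_of_lt (a := (4 : ℝ)) (by norm_num)
    (show _ < 4 * Real.log (n + 3) by linarith)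
  simp only [value]
  linarith

theorem value_lt_half (n : ℕ) : value n < 1 / 2 := by
  have h := one_lt_log_add_three n
  have : 0 < 1 / (4 * Real.log (n + 3)) := by positivity
  simp only [value]
  linarith

theorem value_pos (n : ℕ) : 0 < value n := by linarith [quarter_lt_value n]

theorem cost_pos (n : ℕ) : 0 < cost n := by
  have := strictMono_value (Nat.lt_succ_self n)
  simp only [cost]
  linarith

theorem value_mul_cos_tilt (n : ℕ) : value n * Real.cos (tilt n) = value n - cost n := by
  have h0 := value_pos n
  have h1 := cost_pos n
  have h2 : cost n ≤ 2 * value n := by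
    have := quarter_lt_value n
    have := value_lt_half (n + 1)
    simp only [cost]
    linarith
  have h3 : cost n / value n ≤ 2 := (div_le_iff₀ h0).2 h2
  have h4 : 0 < cost n / value n := by positivity
  rw [tilt, Real.cos_arccos (by linarith) (by linarith)]
  field_simp

theorem coe_postVar (n : ℕ) : (postVar n : ℝ) = -2 * Real.log (value n) := by
  have := Real.log_nonpos (value_pos n).le (by linarith [value_lt_half n])
  rw [postVar, Real.coe_toNNReal _ (by linarith)]

theorem exp_neg_postVar (n : ℕ) : Real.exp (-(postVar n : ℝ) / 2) = value n := by
  rw [coe_postVar, show -(-2 * Real.log (value n)) / 2 = Real.log (value n) by ring,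
    Real.exp_log (value_pos n)]

theorem postVar_pos (n : ℕ) : 0 < postVar n := by
  have := Real.log_neg (value_pos n) (by linarith [value_lt_half n])
  rw [← NNReal.coe_pos, coe_postVar]
  linarith

theorem postVar_succ_lt (n : ℕ) : postVar (n + 1) < postVar n := by
  have := Real.log_lt_log (value_pos n) (strictMono_value (Nat.lt_succ_self n))
  rw [← NNReal.coe_lt_coe, coe_postVar, coe_postVar]
  simp only [Nat.succ_eq_add_one] at this
  linarith

theorem noise_pos : ∀ n, 0 < noise n
  | 0 => one_pos
  | n + 1 => div_pos (mul_pos (postVar_pos n) (postVar_pos _)) (tsub_pos_of_lt (postVar_succ_lt n))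

/-- The posterior variance after the observation of stage `n + 1`. -/
theorem postVar_succ (n : ℕ) :
    postVar (n + 1) = postVar n * noise (n + 1) / (postVar n + noise (n + 1)) := by
  have h0 : (0 : ℝ) < postVar n := postVar_pos n
  have h1 : (0 : ℝ) < postVar (n + 1) := postVar_pos (n + 1)
  have h2 : (postVar (n + 1) : ℝ) < postVar n := postVar_succ_lt n
  have h3 : (postVar n : ℝ) - postVar (n + 1) ≠ 0 := by linarith
  apply NNReal.coe_injective
  simp only [noise, NNReal.coe_div, NNReal.coe_mul, NNReal.coe_add,
    NNReal.coe_sub (postVar_succ_lt n).le]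
  have h4 : (postVar n : ℝ) + postVar n * postVar (n + 1) / (postVar n - postVar (n + 1))
      = postVar n ^ 2 / (postVar n - postVar (n + 1)) := by
    field_simp
    ring
  rw [h4]
  field_simp

theorem le_cost (n : ℕ) : 1 / (2 * (n + 4) * Real.log (n + 4) ^ 2) ≤ cost n := by
  have h3 := one_lt_log_add_three n
  have h34 : Real.log (n + 3) < Real.log (n + 4) :=
    Real.log_lt_log (by positivity) (by linarith)
  have hd : 1 / ((n : ℝ) + 4) ≤ Real.log (n + 4) - Real.log (n + 3) := by
    have := Real.one_sub_inv_le_log_of_pos (x := ((n : ℝ) + 4) / (n + 3)) (by positivity)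
    rw [Real.log_div (by positivity) (by positivity)] at this
    refine le_trans (le_of_eq ?_) this
    field_simp
    ring
  have hc : cost n = (Real.log (n + 4) - Real.log (n + 3)) /
      (2 * (Real.log (n + 3) * Real.log (n + 4))) := by
    have : ((n + 1 : ℕ) : ℝ) + 3 = n + 4 := by push_cast; ring
    simp only [cost, value, this]
    have : Real.log (n + 3) ≠ 0 := by linarith
    have : Real.log (n + 4) ≠ 0 := by linarith
    field_simp
    ring
  have h4 : 0 < Real.log (n + 4) := by linarith
  have h3' : 0 < Real.log (n + 3) := by linarith
  rw [hc]
  calc 1 / (2 * (n + 4) * Real.log (n + 4) ^ 2)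
      = (1 / ((n : ℝ) + 4)) / (2 * (Real.log (n + 4) * Real.log (n + 4))) := by
        field_simp
    _ ≤ _ := by gcongr

/-- The costs decrease more slowly than any power `n ^ (-β)` with `β > 1`. -/
theorem exists_rpow_le_cost {β : ℝ} (hβ : 1 < β) :
    ∃ c : ℝ, 0 < c ∧ ∀ n : ℕ, c * ((n : ℝ) + 4) ^ (-β) ≤ cost n := by
  set r := (β - 1) / 2 with hr
  have hr0 : 0 < r := by rw [hr]; linarith
  refine ⟨r ^ 2 / 2, by positivity, fun n => le_trans ?_ (le_cost n)⟩
  have hn : (0 : ℝ) < n + 4 := by positivity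
  have hl := Real.log_le_rpow_div hn.le hr0
  have hl0 : 0 < Real.log (n + 4) := Real.log_pos (by linarith [(Nat.cast_nonneg n : (0 : ℝ) ≤ n)])
  have h2 : Real.log (n + 4) ^ 2 ≤ ((n : ℝ) + 4) ^ (β - 1) / r ^ 2 := by
    calc Real.log (n + 4) ^ 2 ≤ (((n : ℝ) + 4) ^ r / r) ^ 2 := by gcongr
      _ = _ := by
        rw [div_pow, ← Real.rpow_natCast, ← Real.rpow_mul hn.le]
        congr 2
        rw [hr]; push_cast; ring
  calc r ^ 2 / 2 * ((n : ℝ) + 4) ^ (-β)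
      = 1 / (2 * (n + 4) * (((n : ℝ) + 4) ^ (β - 1) / r ^ 2)) := by
        rw [Real.rpow_neg hn.le, Real.rpow_sub_one hn.ne']
        have : 0 < ((n : ℝ) + 4) ^ β := by positivity
        field_simp
    _ ≤ _ := by gcongr

/-- At least `(c / ε) ^ (1 / β) - 5` costs are as high as `ε`, if the `n`-th one is at least
`c (n + 4) ^ (-β)`. -/
theorem le_encard_of_rpow_le {f : ℕ → ℝ} {c β : ℝ} (hc : 0 < c) (hβ : 0 < β)
    (hf : ∀ n : ℕ, c * ((n : ℝ) + 4) ^ (-β) ≤ f n) {ε : ℝ} (hε : 0 < ε) :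
    ENNReal.ofReal ((c / ε) ^ (1 / β) - 5) ≤ (({n | ε ≤ f n}.encard : ℕ∞) : ℝ≥0∞) := by
  set x := (c / ε) ^ (1 / β) with hx
  have hsub : (Finset.range ⌊x - 4⌋₊ : Set ℕ) ⊆ {n | ε ≤ f n} := by
    intro n hn
    have hn' : ((n + 1 : ℕ) : ℝ) ≤ x - 4 := by
      refine (Nat.le_floor_iff' (Nat.succ_ne_zero n)).1 ?_
      exact Nat.succ_le_of_lt (by simpa using hn)
    push_cast at hn'
    refine le_trans ?_ (hf n)
    have hn4 : (0 : ℝ) < n + 4 := by positivity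
    have h1 : ((n : ℝ) + 4) ^ β ≤ c / ε := by
      calc ((n : ℝ) + 4) ^ β ≤ x ^ β := by gcongr; linarith
        _ = c / ε := by
          rw [hx, ← Real.rpow_mul (by positivity), one_div_mul_cancel hβ.ne', Real.rpow_one]
    rw [Real.rpow_neg hn4.le, ← div_eq_mul_inv, le_div_iff₀ (by positivity)]
    rw [le_div_iff₀ hε] at h1
    linarith
  have hcard : ((⌊x - 4⌋₊ : ℕ) : ℕ∞) ≤ {n | ε ≤ f n}.encard := by
    have := Set.encard_le_encard hsub
    rwa [Set.encard_coe_eq_coe_finsetCard, Finset.card_range] at this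
  calc ENNReal.ofReal (x - 5) ≤ ENNReal.ofReal ((⌊x - 4⌋₊ : ℕ) : ℝ) := by
        apply ENNReal.ofReal_le_ofReal
        linarith [Nat.lt_floor_add_one (x - 4)]
    _ = (((⌊x - 4⌋₊ : ℕ) : ℕ∞) : ℝ≥0∞) := by simp
    _ ≤ _ := by exact_mod_cast hcard

theorem tendsto_rpow_mul_encard_cost {α : ℝ} (hα : α < 1) :
    Tendsto (fun ε : ℝ => ENNReal.ofReal (ε ^ α) * (({n | ε ≤ cost n}.encard : ℕ∞) : ℝ≥0∞))
      (𝓝[>] 0) (𝓝 ⊤) := by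
  -- A negative exponent is replaced by `0`, and `β > 1` is such that `a β < 1`.
  set a := max α 0 with ha
  have ha0 : 0 ≤ a := le_max_right _ _
  have ha1 : a < 1 := max_lt hα one_pos
  set β := 2 / (1 + a) with hβ
  have hβ1 : 1 < β := by rw [hβ, lt_div_iff₀ (by linarith)]; linarith
  have hβa : a - 1 / β < 0 := by
    rw [hβ, one_div_div]; linarith
  obtain ⟨c, hc, hcost⟩ := exists_rpow_le_cost hβ1
  have hlim : Tendsto (fun ε : ℝ => c ^ (1 / β) * ε ^ (a - 1 / β) - 5) (𝓝[>] 0) atTop := by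
    refine tendsto_atTop_add_const_right _ _ (Tendsto.const_mul_atTop (by positivity) ?_)
    exact tendsto_rpow_neg_nhdsGT_zero hβa
  refine tendsto_nhds_top_mono (ENNReal.tendsto_ofReal_nhds_top.2 hlim) ?_
  have h1 : ∀ᶠ ε : ℝ in 𝓝[>] 0, ε < 1 :=
    eventually_nhdsWithin_of_eventually_nhds (eventually_lt_nhds one_pos)
  filter_upwards [self_mem_nhdsWithin, h1] with ε (hε : 0 < ε) hε1
  have hεa : ε ^ a ≤ ε ^ α := Real.rpow_le_rpow_of_exponent_ge hε hε1.le (le_max_left _ _)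
  have hεa1 : ε ^ a ≤ 1 := Real.rpow_le_one hε.le hε1.le ha0
  have hεa0 : 0 ≤ ε ^ a := by positivity
  calc ENNReal.ofReal (c ^ (1 / β) * ε ^ (a - 1 / β) - 5)
      ≤ ENNReal.ofReal (ε ^ a * ((c / ε) ^ (1 / β) - 5)) := by
        apply ENNReal.ofReal_le_ofReal
        rw [Real.div_rpow hc.le hε.le, Real.rpow_sub hε]
        have : ε ^ a * (c ^ (1 / β) / ε ^ (1 / β) - 5)
          = c ^ (1 / β) * (ε ^ a / ε ^ (1 / β)) - 5 * ε ^ a := by ring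
        rw [this]
        linarith
    _ = ENNReal.ofReal (ε ^ a) * ENNReal.ofReal ((c / ε) ^ (1 / β) - 5) :=
        ENNReal.ofReal_mul hεa0
    _ ≤ _ := mul_le_mul' (ENNReal.ofReal_le_ofReal hεa)
        (le_encard_of_rpow_le hc (by linarith) hcost hε)

/-! ### Discounted sums -/

theorem summable_discounted {x : ℕ → ℝ} {δ C : ℝ} (hδ0 : 0 ≤ δ) (hδ1 : δ < 1)
    (hx : ∀ n, |x n| ≤ C) : Summable fun n => δ ^ n * x n := by
  refine Summable.of_norm_bounded ((summable_geometric_of_lt_one hδ0 hδ1).mul_right C) fun n => ?_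
  rw [Real.norm_eq_abs, abs_mul, abs_of_nonneg (pow_nonneg hδ0 n)]
  exact mul_le_mul_of_nonneg_left (hx n) (pow_nonneg hδ0 n)

theorem abs_value_sub_cost_le (n : ℕ) : |value n - cost n| ≤ 1 := by
  rw [← value_mul_cos_tilt, abs_mul, abs_of_pos (value_pos n)]
  exact mul_le_one₀ (by linarith [value_lt_half n]) (abs_nonneg _) (Real.abs_cos_le_one _)

/-- To stop experimenting at stage `k`, and to get the reward `value k` from then on, is worse than
to experiment forever, because the gains `value n - value k` (`n ≥ k`) make up for the costs. -/
theorem discounted_stop_lt {δ : ℝ} (hδ : 2 / 3 < δ) (hδ1 : δ < 1) (k : ℕ) {r : ℕ → ℝ}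
    (hlt : ∀ n < k, r n = value n - cost n) (hge : ∀ n, k ≤ n → r n = value k) :
    ∑' n, δ ^ n * r n < ∑' n, δ ^ n * (value n - cost n) := by
  have hδ0 : 0 < δ := by linarith
  set x : ℕ → ℝ := fun n => value (max n k) - value k with hx
  have hx0 : ∀ n, 0 ≤ x n := fun n => sub_nonneg.2 (strictMono_value.monotone (le_max_right _ _))
  have hx1 : ∀ n, |x n| ≤ 1 := fun n => by
    rw [abs_of_nonneg (hx0 n)]
    have := value_lt_half (max n k)
    have := value_pos k
    simp only [hx]
    linarith
  have hs : Summable fun n => δ ^ n * x n := summable_discounted hδ0.le hδ1 hx1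
  have hs' : Summable fun n => δ ^ n * x (n + 1) :=
    summable_discounted hδ0.le hδ1 fun n => hx1 (n + 1)
  have hv : Summable fun n => δ ^ n * (value n - cost n) :=
    summable_discounted hδ0.le hδ1 abs_value_sub_cost_le
  have hr : ∀ n, δ ^ n * r n
      = δ ^ n * (value n - cost n) - (3 * (δ ^ n * x n) - 2 * (δ ^ n * x (n + 1))) := by
    intro n
    rcases lt_or_ge n k with h | h
    · rw [hlt n h]
      simp [hx, h.le, Nat.succ_le_of_lt h]
    · rw [hge n h]
      simp only [hx, max_eq_left h, max_eq_left (Nat.le_succ_of_le h), cost]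
      ring
  have hshift : δ * ∑' n, δ ^ n * x (n + 1) = ∑' n, δ ^ n * x n := by
    rw [hs.tsum_eq_zero_add, ← tsum_mul_left]
    simp only [hx, zero_le, max_eq_right, sub_self, mul_zero, zero_add]
    exact tsum_congr fun n => by rw [pow_succ]; ring
  have hpos : 0 < ∑' n, δ ^ n * x (n + 1) := by
    refine hs'.tsum_pos (fun n => mul_nonneg (by positivity) (hx0 _)) k (mul_pos (by positivity) ?_)
    exact sub_pos.2 (strictMono_value (by simp))
  simp_rw [hr]
  rw [hv.tsum_sub ((hs.mul_left 3).sub (hs'.mul_left 2)),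
    (hs.mul_left 3).tsum_sub (hs'.mul_left 2), tsum_mul_left, tsum_mul_left, ← hshift]
  nlinarith

theorem integral_discounted {Ω : Type*} [MeasurableSpace Ω] {P : Measure Ω} [IsProbabilityMeasure P]
    {X : ℕ → Ω → ℝ} (hX : ∀ n, Measurable (X n)) (hX1 : ∀ n ω, |X n ω| ≤ 1) {δ : ℝ} (hδ0 : 0 ≤ δ)
    (hδ1 : δ < 1) : ∫ ω, ∑' n, δ ^ n * X n ω ∂P = ∑' n, δ ^ n * ∫ ω, X n ω ∂P := by
  have hint : ∀ n, Integrable (X n) P := fun n =>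
    Integrable.of_bound (hX n).aestronglyMeasurable 1 (ae_of_all _ fun ω => hX1 n ω)
  rw [← integral_tsum_of_summable_integral_norm (F := fun n ω => δ ^ n * X n ω)
    (fun n => (hint n).const_mul _)]
  · simp_rw [integral_const_mul]
  · refine Summable.of_nonneg_of_le (fun n => integral_nonneg fun ω => norm_nonneg _) (fun n => ?_)
      (summable_geometric_of_lt_one hδ0 hδ1)
    calc ∫ ω, ‖δ ^ n * X n ω‖ ∂P ≤ ∫ _, δ ^ n ∂P := by
          refine integral_mono ((hint n).const_mul _).norm (integrable_const _) fun ω => ?_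
          simp only [norm_mul, norm_pow, Real.norm_eq_abs, abs_of_nonneg hδ0]
          exact mul_le_of_le_one_right (by positivity) (hX1 n ω)
      _ = δ ^ n := by simp

/-! ### The law of the plays -/

/-- The history of the stages before `n` along a play. -/
def Play.hist {Θ S A : Type u} (ω : Play Θ S A) (n : ℕ) : Fin n → S × A := fun i => ω.2 i

/-- The information that was available at stage `n`, as recorded in the history of the stages up to
`n`. -/
def lastInfo {S A : Type u} {n : ℕ} (h : Fin (n + 1) → S × A) : Info S A n :=
  (fun i => h i.castSucc, (h (Fin.last n)).1)

/-- The history of the stages up to `n`, from the information at stage `n` and the action. -/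
def addAction {n : ℕ} (i : Info S A n) (a : A) : Fin (n + 1) → S × A :=
  Fin.snoc (α := fun _ => S × A) i.1 (i.2, a)

theorem Play.addAction_info {Θ S A : Type u} (ω : Play Θ S A) (n : ℕ) :
    addAction (ω.info n) (ω.2 n).2 = ω.hist (n + 1) := by
  funext j
  refine Fin.lastCases ?_ (fun k => ?_) j
  · simp [addAction, Play.info, Play.hist]
  · simp [addAction, Play.info, Play.hist]

section Law

variable {Θ S A : Type u} [MeasurableSpace Θ] [MeasurableSpace S] [MeasurableSpace A]

theorem Play.measurable_hist (n : ℕ) : Measurable fun ω : Play Θ S A => ω.hist n :=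
  measurable_pi_lambda _ fun i => (measurable_pi_apply (i : ℕ)).comp measurable_snd

theorem Play.measurable_info (n : ℕ) : Measurable fun ω : Play Θ S A => ω.info n :=
  (Play.measurable_hist n).prodMk
    (measurable_fst.comp ((measurable_pi_apply n).comp measurable_snd))

theorem Play.measurable_action (n : ℕ) : Measurable fun ω : Play Θ S A => (ω.2 n).2 :=
  measurable_snd.comp ((measurable_pi_apply n).comp measurable_snd)

theorem measurable_lastInfo (n : ℕ) : Measurable (lastInfo (S := S) (A := A) (n := n)) :=
  (measurable_pi_lambda _ fun i => measurable_pi_apply i.castSucc).prodMk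
    (measurable_fst.comp (measurable_pi_apply (Fin.last n)))

theorem measurable_addAction (n : ℕ) :
    Measurable fun p : Info S A n × A => addAction p.1 p.2 := by
  refine measurable_pi_lambda _ fun j => ?_
  refine Fin.lastCases ?_ (fun k => ?_) j
  · simp only [addAction, Fin.snoc_last]
    fun_prop
  · simp only [addAction, Fin.snoc_castSucc]
    fun_prop

variable [TopologicalSpace A] [CompactSpace A] [TopologicalSpace.MetrizableSpace A] [Nonempty A]
  [BorelSpace A] (D : DecisionProblem Θ S A) (σ : DecisionRule S A)

namespace DecisionProblem

theorem lintegral_law_param {f : Θ → ℝ≥0∞} (hf : Measurable f) :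
    ∫⁻ ω, f ω.1 ∂(D.law σ) = ∫⁻ θ, f θ ∂D.prior := by
  have h : (Kernel.trajMeasure D.coordPrior (D.coordKernel σ)).map (fun x => x 0)
      = D.coordPrior := by
    have h1 := Kernel.traj_map_frestrictLe (κ := D.coordKernel σ) 0 0
    have h2 : (Kernel.trajMeasure D.coordPrior (D.coordKernel σ)).map (Preorder.frestrictLe 0)
        = D.coordPrior.map (MeasurableEquiv.piUnique _).symm := by
      rw [Kernel.trajMeasure, Measure.map_comp _ _ (by fun_prop), h1, Kernel.partialTraj_self,
        Measure.id_comp]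
    have h3 := congrArg (Measure.map
      (MeasurableEquiv.piUnique (fun i : Finset.Iic 0 => Coord Θ S A i))) h2
    rw [Measure.map_map (by fun_prop) (by fun_prop)] at h3
    exact h3.trans (MeasurableEquiv.map_map_symm _)
  rw [law, lintegral_map (f := fun ω : Play Θ S A => f ω.1) (hf.comp measurable_fst)
    Coord.measurable_toPlay]
  have h4 := lintegral_map (μ := Kernel.trajMeasure D.coordPrior (D.coordKernel σ))
    (g := fun x => x 0) (f := f) hf (measurable_pi_apply 0)
  exact h4.symm.trans (congrArg (fun μ : Measure Θ => ∫⁻ θ, f θ ∂μ) h)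

/-- Given the parameter and the history, the next observation and action are drawn from
`stageKernel`. -/
theorem lintegral_law_stage (n : ℕ) {f : (Θ × (Fin n → S × A)) → S × A → ℝ≥0∞}
    (hf : Measurable (Function.uncurry f)) :
    ∫⁻ ω, f (ω.1, ω.hist n) (ω.2 n) ∂(D.law σ)
      = ∫⁻ ω, ∫⁻ x, f (ω.1, ω.hist n) x ∂(D.stageKernel σ n (ω.1, ω.hist n)) ∂(D.law σ) := by
  have hpast : Measurable fun ω : Play Θ S A => (ω.1, ω.hist n) :=
    measurable_fst.prodMk (Play.measurable_hist n)
  have hin : Measurable fun p => ∫⁻ x, f p x ∂(D.stageKernel σ n p) :=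
    Measurable.lintegral_kernel_prod_right hf
  have hcoord : Measurable fun p : ((i : Finset.Iic n) → Coord Θ S A i) × Coord Θ S A (n + 1) =>
      f (Coord.past n p.1) p.2 :=
    hf.comp (((Coord.measurable_past n).comp measurable_fst).prodMk measurable_snd)
  rw [law, lintegral_map (f := fun ω : Play Θ S A => f (ω.1, ω.hist n) (ω.2 n))
      (hf.comp (hpast.prodMk ((measurable_pi_apply n).comp measurable_snd)))
      Coord.measurable_toPlay,
    lintegral_map (f := fun ω : Play Θ S A => ∫⁻ x, f (ω.1, ω.hist n) x
      ∂(D.stageKernel σ n (ω.1, ω.hist n))) (hin.comp hpast) Coord.measurable_toPlay]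
  have h := Kernel.map_frestrictLe_trajMeasure_compProd_eq_map_trajMeasure
    (μ₀ := D.coordPrior) (κ := D.coordKernel σ) (a := n)
  have h1 := congrArg (fun μ => ∫⁻ p, f (Coord.past n p.1) p.2 ∂μ) h
  beta_reduce at h1
  rw [lintegral_map hcoord (by fun_prop), Measure.lintegral_compProd hcoord,
    lintegral_map (Measurable.lintegral_kernel_prod_right (κ := D.coordKernel σ n)
      (f := fun x c => f (Coord.past n x) c) hcoord)
      (by fun_prop)] at h1
  exact h1.symm

theorem lintegral_stageKernel (n : ℕ) (p : Θ × (Fin n → S × A)) {g : S × A → ℝ≥0∞}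
    (hg : Measurable g) :
    ∫⁻ x, g x ∂(D.stageKernel σ n p) = ∫⁻ s, g (s, σ.act n (p.2, s)) ∂(D.obs n p) := by
  have hg' : Measurable fun q : (Θ × (Fin n → S × A)) × S => g (q.2, σ.act n (q.1.2, q.2)) :=
    hg.comp (σ.measurable_stage n)
  rw [stageKernel, Kernel.map_apply _ (σ.measurable_stage n),
    lintegral_map hg (σ.measurable_stage n), Kernel.lintegral_prod _ _ _ hg', Kernel.lintegral_id']
  exact Measurable.lintegral_prod_right' hg'

theorem lintegral_law_info (n : ℕ) {f : Θ → Info S A n → ℝ≥0∞}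
    (hf : Measurable (Function.uncurry f)) :
    ∫⁻ ω, f ω.1 (ω.info n) ∂(D.law σ)
      = ∫⁻ ω, ∫⁻ s, f ω.1 (ω.hist n, s) ∂(D.obs n (ω.1, ω.hist n)) ∂(D.law σ) := by
  have hf' : Measurable (Function.uncurry fun (p : Θ × (Fin n → S × A)) (x : S × A) =>
      f p.1 (p.2, x.1)) :=
    hf.comp (f := fun q : (Θ × (Fin n → S × A)) × (S × A) => (q.1.1, (q.1.2, q.2.1)))
      (by fun_prop)
  refine (D.lintegral_law_stage σ n hf').trans (lintegral_congr fun ω => ?_)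
  have hx : Measurable fun x : S × A => f ω.1 (ω.hist n, x.1) :=
    hf.comp (f := fun x : S × A => (ω.1, (ω.hist n, x.1))) (by fun_prop)
  rw [D.lintegral_stageKernel σ n _ hx]

/-- The action of stage `n` is the one that the rule prescribes. -/
theorem ae_action_eq [SecondCountableTopology A] (n : ℕ) :
    ∀ᵐ ω ∂(D.law σ), (ω.2 n).2 = σ.act n (ω.info n) := by
  let B : Set ((Θ × (Fin n → S × A)) × (S × A)) := {p | p.2.2 = σ.act n (p.1.2, p.2.1)}
  have hB : MeasurableSet B :=
    measurableSet_eq_fun (by fun_prop) ((σ.measurable_act n).comp (by fun_prop))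
  have hg : Measurable (Bᶜ.indicator fun _ => (1 : ℝ≥0∞)) := measurable_const.indicator hB.compl
  have h := D.lintegral_law_stage σ n (f := fun p x => Bᶜ.indicator (fun _ => 1) (p, x)) hg
  have h0 : ∀ p, ∫⁻ x, Bᶜ.indicator (fun _ => (1 : ℝ≥0∞)) (p, x) ∂(D.stageKernel σ n p) = 0 := by
    intro p
    have hx : Measurable fun x : S × A => Bᶜ.indicator (fun _ => (1 : ℝ≥0∞)) (p, x) :=
      hg.comp measurable_prodMk_left
    rw [D.lintegral_stageKernel σ n _ hx]
    simp [B]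
  simp only [h0, lintegral_zero] at h
  have hω : Measurable fun ω : Play Θ S A => ((ω.1, ω.hist n), ω.2 n) :=
    (measurable_fst.prodMk (Play.measurable_hist n)).prodMk
      ((measurable_pi_apply n).comp measurable_snd)
  have h1 := (lintegral_eq_zero_iff (hg.comp hω)).1 h
  filter_upwards [h1] with ω hω
  by_contra hne
  have : ((ω.1, ω.hist n), ω.2 n) ∈ Bᶜ := hne
  simp [Set.indicator_of_mem this] at hω

/-- If the plays of `σ` almost surely are as `τ` prescribes, then the histories have the same law
under both rules. -/
theorem lintegral_law_hist_congr [SecondCountableTopology A] {σ τ : DecisionRule S A}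
    (h : ∀ n, ∀ᵐ ω ∂(D.law σ), (ω.2 n).2 = τ.act n (ω.info n)) (n : ℕ)
    {f : Θ → (Fin n → S × A) → ℝ≥0∞} (hf : Measurable (Function.uncurry f)) :
    ∫⁻ ω, f ω.1 (ω.hist n) ∂(D.law σ) = ∫⁻ ω, f ω.1 (ω.hist n) ∂(D.law τ) := by
  induction n with
  | zero =>
    have hf0 : Measurable fun θ => f θ (fun i => i.elim0) := hf.comp measurable_prodMk_right
    have h0 : ∀ ω : Play Θ S A, ω.hist 0 = fun i => i.elim0 := fun ω => Subsingleton.elim _ _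
    simp_rw [h0]
    rw [D.lintegral_law_param σ hf0, D.lintegral_law_param τ hf0]
  | succ n ih =>
    have hg : Measurable (Function.uncurry fun (θ : Θ) (i : Info S A n) =>
        f θ (addAction i (τ.act n i))) := by
      refine hf.comp (measurable_fst.prodMk ((measurable_addAction n).comp
        (measurable_snd.prodMk ((τ.measurable_act n).comp measurable_snd))))
    have key : ∀ {ρ : DecisionRule S A}, (∀ᵐ ω ∂(D.law ρ), (ω.2 n).2 = τ.act n (ω.info n)) →
        ∫⁻ ω, f ω.1 (ω.hist (n + 1)) ∂(D.law ρ) = ∫⁻ ω, ∫⁻ s, f ω.1 (addAction (ω.hist n, s)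
          (τ.act n (ω.hist n, s))) ∂(D.obs n (ω.1, ω.hist n)) ∂(D.law ρ) := by
      intro ρ hρ
      rw [← D.lintegral_law_info ρ n hg]
      refine lintegral_congr_ae (hρ.mono fun ω hω => ?_)
      simp only
      rw [← ω.addAction_info, hω]
    rw [key (h n), key (D.ae_action_eq τ n)]
    refine ih (f := fun θ x => ∫⁻ s, f θ (addAction (x, s) (τ.act n (x, s))) ∂(D.obs n (θ, x))) ?_
    exact Measurable.lintegral_kernel_prod_right (κ := D.obs n)
      (f := fun p s => f p.1 (addAction (p.2, s) (τ.act n (p.2, s))))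
      (hg.comp (f := fun q : (Θ × (Fin n → S × A)) × S => (q.1.1, (q.1.2, q.2))) (by fun_prop))

/-- If the plays of `σ` almost surely are as `τ` prescribes, then `σ` almost surely plays as `τ`
does when `τ` is used. -/
theorem playsAs_of_ae_action_eq [SecondCountableTopology A] {σ τ : DecisionRule S A}
    (h : ∀ n, ∀ᵐ ω ∂(D.law σ), (ω.2 n).2 = τ.act n (ω.info n)) : D.PlaysAs σ τ := by
  refine ae_all_iff.2 fun n => ?_
  let B : Set (Info S A n) := {i | σ.act n i = τ.act n i}
  have hB : MeasurableSet B := measurableSet_eq_fun (σ.measurable_act n) (τ.measurable_act n)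
  let g : Info S A n → ℝ≥0∞ := Bᶜ.indicator fun _ => 1
  have hg : Measurable g := measurable_const.indicator hB.compl
  have hg' : Measurable (Function.uncurry fun (_ : Θ) (i : Info S A n) => g i) :=
    hg.comp measurable_snd
  have hgσ : ∫⁻ ω, g (ω.info n) ∂(D.law σ) = 0 := by
    refine (lintegral_eq_zero_iff (hg.comp (Play.measurable_info n))).2 ?_
    filter_upwards [h n, D.ae_action_eq σ n] with ω h1 h2
    have : ω.info n ∉ Bᶜ := fun hne => hne (h2.symm.trans h1)
    simp [g, Set.indicator_of_notMem this]
  have hgτ : ∫⁻ ω, g (ω.info n) ∂(D.law τ) = 0 := by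
    rw [← hgσ, D.lintegral_law_info σ n hg', D.lintegral_law_info τ n hg']
    exact (D.lintegral_law_hist_congr h n (f := fun θ x => ∫⁻ s, g (x, s) ∂(D.obs n (θ, x)))
      (Measurable.lintegral_kernel_prod_right (κ := D.obs n) (f := fun p s => g (p.2, s))
        (hg.comp (f := fun q : (Θ × (Fin n → S × A)) × S => (q.1.2, q.2)) (by fun_prop)))).symm
  filter_upwards [(lintegral_eq_zero_iff (hg.comp (Play.measurable_info n))).1 hgτ] with ω hω
  by_contra hne
  have : ω.info n ∈ Bᶜ := hne
  simp [g, Set.indicator_of_mem this] at hω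

end DecisionProblem

end Law

/-! ### Histories that follow a rule -/

section Follows

variable {S A : Type u} [MeasurableSpace S] [MeasurableSpace A] (a : DecisionRule S A)

theorem DecisionRule.follows_succ_iff {n : ℕ} (h : Fin (n + 1) → S × A) :
    a.Follows h ↔ a.Follows (lastInfo h).1 ∧ (h (Fin.last n)).2 = a.act n (lastInfo h) := by
  constructor
  · exact fun hf => ⟨fun k => hf k.castSucc, hf (Fin.last n)⟩
  · rintro ⟨h1, h2⟩ k
    refine Fin.lastCases ?_ (fun k => ?_) k
    · exact h2
    · exact h1 k

theorem DecisionRule.follows_zero (h : Fin 0 → S × A) : a.Follows h := fun k => k.elim0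

theorem DecisionRule.measurableSet_follows [TopologicalSpace A] [SecondCountableTopology A]
    [TopologicalSpace.MetrizableSpace A] [BorelSpace A] (n : ℕ) :
    MeasurableSet {h : Fin n → S × A | a.Follows h} := by
  simp only [DecisionRule.Follows, Set.ofPred_forall]
  refine MeasurableSet.iInter fun k => measurableSet_eq_fun (by fun_prop)
    ((a.measurable_act k).comp (Measurable.prodMk ?_ (by fun_prop)))
  exact measurable_pi_lambda _ fun i => measurable_pi_apply _

end Follows

/-! ### The Gaussian problem -/

/-- The posterior mean of the parameter: it is updated by Bayes' rule after each observation. The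
gains are those that are correct as long as the prescribed actions are played; they do not matter
later, because then nothing is observed. -/
def postMean : ∀ n : ℕ, Info (Unit ⊕ ℝ) EReal n → ℝ
  | 0, _ => 0
  | n + 1, i => Sum.elim (fun _ => postMean n (lastInfo i.1))
      (fun y => postMean n (lastInfo i.1)
        + postVar n / (postVar n + noise (n + 1)) * (y - postMean n (lastInfo i.1))) i.2

theorem measurable_postMean : ∀ n, Measurable (postMean n)
  | 0 => measurable_const
  | n + 1 => by
    have h1 : Measurable (Sum.elim (fun _ => 0) (fun _ => 1) : Unit ⊕ ℝ → ℝ) :=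
      measurable_const.sumElim measurable_const
    have h2 : Measurable (Sum.elim (fun _ => 0) id : Unit ⊕ ℝ → ℝ) :=
      measurable_const.sumElim measurable_id
    have h3 : Measurable fun i : Info (Unit ⊕ ℝ) EReal (n + 1) => postMean n (lastInfo i.1) :=
      (measurable_postMean n).comp ((measurable_lastInfo n).comp measurable_fst)
    have h4 : postMean (n + 1) = fun i => postMean n (lastInfo i.1)
        + (Sum.elim (fun _ => 0) (fun _ => 1) : Unit ⊕ ℝ → ℝ) i.2
          * (postVar n / (postVar n + noise (n + 1))
            * ((Sum.elim (fun _ => 0) id : Unit ⊕ ℝ → ℝ) i.2 - postMean n (lastInfo i.1))) := by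
      funext ⟨h, s⟩
      cases s <;> simp [postMean]
    rw [h4]
    exact h3.add ((h1.comp measurable_snd).mul
      (((h2.comp measurable_snd).sub h3).const_mul _))

/-- The prescribed actions: the angle differs by `tilt n` from the posterior mean, which is the
angle of the myopically optimal action. -/
def prescribed : DecisionRule (Unit ⊕ ℝ) EReal where
  act n i := ofAngle (postMean n i + tilt n)
  measurable_act n := measurable_ofAngle.comp ((measurable_postMean n).add_const _)

open Classical in
/-- The number of informative observations that are available when the action of stage `n` is
chosen: `n` as long as the prescribed actions are played, and the stage of the first deviation
later. -/
def numObs : ∀ n : ℕ, (Fin n → (Unit ⊕ ℝ) × EReal) → ℕ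
  | 0, _ => 0
  | n + 1, h => if prescribed.Follows h then n + 1 else numObs n (lastInfo h).1

theorem numObs_of_follows : ∀ {n : ℕ} {h : Fin n → (Unit ⊕ ℝ) × EReal}, prescribed.Follows h →
    numObs n h = n
  | 0, _, _ => rfl
  | _ + 1, _, hf => if_pos hf

theorem measurable_numObs : ∀ n, Measurable (numObs n)
  | 0 => measurable_const
  | n + 1 => Measurable.ite (prescribed.measurableSet_follows (n + 1)) measurable_const
      ((measurable_numObs n).comp (measurable_fst.comp (measurable_lastInfo n)))

/-- An informative observation: the law `N(θ, v)`, carried to the observation space, given `θ`. -/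
def signalKernel (v : ℝ≥0) : Kernel ℝ (Unit ⊕ ℝ) :=
  Kernel.map ⟨fun θ => gaussianReal θ v,
    measurable_gaussianReal.comp (f := fun θ : ℝ => (θ, v)) (by fun_prop)⟩ Sum.inr

theorem signalKernel_apply (v : ℝ≥0) (θ : ℝ) :
    signalKernel v θ = (gaussianReal θ v).map Sum.inr :=
  Kernel.map_apply _ measurable_inr _

instance isMarkovKernel_signalKernel (v : ℝ≥0) : IsMarkovKernel (signalKernel v) :=
  ⟨fun θ => by
    rw [signalKernel_apply]
    exact Measure.isProbabilityMeasure_map measurable_inr.aemeasurable⟩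

theorem measurableSet_informative (n : ℕ) :
    MeasurableSet {p : ℝ × (Fin n → (Unit ⊕ ℝ) × EReal) | n ≠ 0 ∧ prescribed.Follows p.2} :=
  (MeasurableSet.const _).inter (measurable_snd (prescribed.measurableSet_follows n))

open Classical in
/-- The law of the observation of stage `n`. -/
def gaussianObs (n : ℕ) : Kernel (ℝ × (Fin n → (Unit ⊕ ℝ) × EReal)) (Unit ⊕ ℝ) :=
  Kernel.piecewise (measurableSet_informative n)
    ((signalKernel (noise n)).comap Prod.fst measurable_fst)
    (Kernel.const _ (Measure.dirac (.inl ())))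

instance isMarkovKernel_gaussianObs (n : ℕ) : IsMarkovKernel (gaussianObs n) := by
  unfold gaussianObs
  infer_instance

theorem gaussianObs_of_follows {n : ℕ} (hn : n ≠ 0) (θ : ℝ) {h : Fin n → (Unit ⊕ ℝ) × EReal}
    (hf : prescribed.Follows h) :
    gaussianObs n (θ, h) = (gaussianReal θ (noise n)).map Sum.inr := by
  classical
  exact (if_pos ⟨hn, hf⟩).trans (signalKernel_apply _ _)

theorem gaussianObs_of_not {n : ℕ} (θ : ℝ) {h : Fin n → (Unit ⊕ ℝ) × EReal}
    (hf : ¬ (n ≠ 0 ∧ prescribed.Follows h)) :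
    gaussianObs n (θ, h) = Measure.dirac (.inl ()) := by
  classical
  exact if_neg hf

theorem iSup_cos_sub_angle (m : ℝ) {c : ℝ} (hc : 0 ≤ c) :
    ⨆ a, c * Real.cos (m - angle a) = c := by
  have hle : ∀ a, c * Real.cos (m - angle a) ≤ c := fun a =>
    mul_le_of_le_one_right hc (Real.cos_le_one _)
  refine le_antisymm (ciSup_le hle) ?_
  refine le_ciSup_of_le ⟨c, by rintro _ ⟨a, rfl⟩; exact hle a⟩ (ofAngle m) ?_
  rw [cos_sub_angle_ofAngle]
  simp

theorem iInf_cos_sub_angle (m : ℝ) : ⨅ a, Real.cos (m - angle a) = -1 := by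
  refine le_antisymm ?_ (le_ciInf fun a => Real.neg_one_le_cos _)
  refine ciInf_le_of_le ⟨-1, by rintro _ ⟨a, rfl⟩; exact Real.neg_one_le_cos _⟩
    (ofAngle (m - Real.pi)) ?_
  rw [cos_sub_angle_ofAngle]
  simp

/-- The decision problem: to guess the parameter modulo `2π`. The reward is the cosine of the
error. -/
def gaussianProblem : DecisionProblem ℝ (Unit ⊕ ℝ) EReal where
  prior := gaussianReal 0 (postVar 0)
  isProbabilityMeasure_prior := inferInstance
  obs := gaussianObs
  isMarkovKernel_obs := inferInstance
  reward θ a := Real.cos (θ - angle a)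
  measurable_reward := (Real.continuous_cos.comp
    (continuous_fst.sub (continuous_angle.comp continuous_snd))).measurable
  continuous_reward θ := Real.continuous_cos.comp (continuous_const.sub continuous_angle)
  integrable_highest := by
    have : ∀ θ, ⨆ a, Real.cos (θ - angle a) = 1 := fun θ => by
      simpa using iSup_cos_sub_angle θ one_pos.le
    simp_rw [this]
    exact integrable_const _
  integrable_lowest := by
    simp_rw [iInf_cos_sub_angle]
    exact integrable_const _

theorem isGaussianProblem_gaussianProblem : IsGaussianProblem gaussianProblem prescribed noise where
  prior_eq := ⟨0, postVar 0, (postVar_pos 0).ne', rfl⟩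
  noise_ne_zero n := (noise_pos n).ne'
  obs_eq n θ h := by
    split_ifs with hf
    · exact gaussianObs_of_follows hf.1 θ hf.2
    · exact gaussianObs_of_not θ hf

/-! ### The posterior distribution -/

/-- The posterior distribution of the parameter at stage `n`; it does not depend on the rule by
which the information was acquired. -/
def postKernel (n : ℕ) : Kernel (Info (Unit ⊕ ℝ) EReal n) ℝ :=
  ⟨fun i => gaussianReal (postMean n i) (postVar (numObs n i.1)),
    measurable_gaussianReal.comp ((measurable_postMean n).prodMk
      ((measurable_of_countable postVar).comp ((measurable_numObs n).comp measurable_fst)))⟩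

theorem postKernel_apply (n : ℕ) (i : Info (Unit ⊕ ℝ) EReal n) :
    postKernel n i = gaussianReal (postMean n i) (postVar (numObs n i.1)) := rfl

instance isMarkovKernel_postKernel (n : ℕ) : IsMarkovKernel (postKernel n) :=
  ⟨fun i => by rw [postKernel_apply]; infer_instance⟩

/-- The distribution of the parameter given the history of the stages before `n`, before the
observation of stage `n`. -/
def interimKernel : ∀ n : ℕ, Kernel (Fin n → (Unit ⊕ ℝ) × EReal) ℝ
  | 0 => Kernel.const _ (gaussianReal 0 (postVar 0))
  | n + 1 => (postKernel n).comap lastInfo (measurable_lastInfo n)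

instance isMarkovKernel_interimKernel : ∀ n : ℕ, IsMarkovKernel (interimKernel n)
  | 0 => inferInstanceAs (IsMarkovKernel (Kernel.const _ (gaussianReal 0 (postVar 0))))
  | n + 1 => inferInstanceAs
      (IsMarkovKernel ((postKernel n).comap lastInfo (measurable_lastInfo n)))

/-- Bayes' rule at a given history: to redraw the parameter from `postKernel` after the observation
does not change the joint law of the parameter and the observation. -/
theorem lintegral_interimKernel (n : ℕ) (h : Fin n → (Unit ⊕ ℝ) × EReal)
    {f : (Unit ⊕ ℝ) → ℝ → ℝ≥0∞} (hf : Measurable (Function.uncurry f)) :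
    ∫⁻ θ, ∫⁻ s, f s θ ∂(gaussianObs n (θ, h)) ∂(interimKernel n h)
      = ∫⁻ θ, ∫⁻ s, ∫⁻ θ', f s θ' ∂(postKernel n (h, s)) ∂(gaussianObs n (θ, h))
          ∂(interimKernel n h) := by
  have hs : ∀ θ, Measurable fun s => f s θ := fun θ => hf.comp measurable_prodMk_right
  have hpost : Measurable fun s => ∫⁻ θ', f s θ' ∂(postKernel n (h, s)) :=
    Measurable.lintegral_kernel_prod_right
      (κ := (postKernel n).comap (fun s => (h, s)) measurable_prodMk_left) hf
  by_cases hn : n ≠ 0 ∧ prescribed.Follows h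
  · obtain ⟨n, rfl⟩ := Nat.exists_eq_succ_of_ne_zero hn.1
    have hw : postVar (n + 1) = _ := postVar_succ n
    have h1 : numObs n (lastInfo h).1 = n :=
      numObs_of_follows ((prescribed.follows_succ_iff h).1 hn.2).1
    have h2 : interimKernel (n + 1) h
        = gaussianReal (postMean n (lastInfo h)) (postVar n) := by
      change gaussianReal _ (postVar (numObs n (lastInfo h).1)) = _
      rw [h1]
    have h3 : ∀ θ, ∫⁻ s, f s θ ∂(gaussianObs (n + 1) (θ, h))
        = ∫⁻ y, f (.inr y) θ ∂(gaussianReal θ (noise (n + 1))) := fun θ => by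
      rw [gaussianObs_of_follows hn.1 θ hn.2, lintegral_map (hs θ) measurable_inr]
    have h4 : ∀ θ, ∫⁻ s, ∫⁻ θ', f s θ' ∂(postKernel (n + 1) (h, s)) ∂(gaussianObs (n + 1) (θ, h))
        = ∫⁻ y, ∫⁻ θ', f (.inr y) θ' ∂(gaussianReal (postMean n (lastInfo h)
          + postVar n / (postVar n + noise (n + 1)) * (y - postMean n (lastInfo h)))
            (postVar (n + 1))) ∂(gaussianReal θ (noise (n + 1))) := fun θ => by
      rw [gaussianObs_of_follows hn.1 θ hn.2, lintegral_map hpost measurable_inr]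
      simp only [postKernel_apply, numObs_of_follows hn.2]
      rfl
    simp only [Nat.succ_eq_add_one, h2, h3, h4]
    exact lintegral_gaussianReal_bayes _ (postVar_pos n).ne' (noise_pos _).ne' hw
      (f := fun y θ => f (.inr y) θ)
      (hf.comp (f := fun p : ℝ × ℝ => ((.inr p.1 : Unit ⊕ ℝ), p.2))
        ((measurable_inr.comp measurable_fst).prodMk measurable_snd))
  · have h1 : postKernel n (h, .inl ()) = interimKernel n h := by
      cases n with
      | zero => rfl
      | succ n =>
        have h2 : numObs (n + 1) h = numObs n (lastInfo h).1 :=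
          if_neg fun hf => hn ⟨Nat.succ_ne_zero n, hf⟩
        change gaussianReal (postMean n (lastInfo h)) (postVar (numObs (n + 1) h)) = _
        rw [h2]
        rfl
    have h3 : ∀ θ, gaussianObs n (θ, h) = Measure.dirac (.inl ()) := fun θ =>
      gaussianObs_of_not θ hn
    simp only [h3, lintegral_dirac' _ hpost, lintegral_dirac' _ (hs _), h1, lintegral_const,
      measure_univ, mul_one]

/-- If `interimKernel` is the conditional law of the parameter before the observation of stage `n`,
then `postKernel` is its conditional law afterwards. -/
theorem lintegral_law_posterior_of_interim (σ : DecisionRule (Unit ⊕ ℝ) EReal) (n : ℕ)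
    (hinterim : ∀ g : (Fin n → (Unit ⊕ ℝ) × EReal) → ℝ → ℝ≥0∞, Measurable (Function.uncurry g) →
      ∫⁻ ω, g (ω.hist n) ω.1 ∂(gaussianProblem.law σ)
        = ∫⁻ ω, ∫⁻ θ, g (ω.hist n) θ ∂(interimKernel n (ω.hist n)) ∂(gaussianProblem.law σ))
    {f : Info (Unit ⊕ ℝ) EReal n → ℝ → ℝ≥0∞} (hf : Measurable (Function.uncurry f)) :
    ∫⁻ ω, f (ω.info n) ω.1 ∂(gaussianProblem.law σ)
      = ∫⁻ ω, ∫⁻ θ, f (ω.info n) θ ∂(postKernel n (ω.info n)) ∂(gaussianProblem.law σ) := by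
  have hobs : ∀ {k : Info (Unit ⊕ ℝ) EReal n → ℝ → ℝ≥0∞}, Measurable (Function.uncurry k) →
      Measurable (Function.uncurry fun (h : Fin n → (Unit ⊕ ℝ) × EReal) (θ : ℝ) =>
        ∫⁻ s, k (h, s) θ ∂(gaussianObs n (θ, h))) := fun {k} hk =>
    Measurable.lintegral_kernel_prod_right
      (κ := (gaussianObs n).comap Prod.swap measurable_swap) (f := fun p s => k (p.1, s) p.2)
      (hk.comp (f := fun q : ((Fin n → (Unit ⊕ ℝ) × EReal) × ℝ) × (Unit ⊕ ℝ) =>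
        ((q.1.1, q.2), q.1.2)) (by fun_prop))
  have hf2 : Measurable (Function.uncurry fun (i : Info (Unit ⊕ ℝ) EReal n) (_ : ℝ) =>
      ∫⁻ θ, f i θ ∂(postKernel n i)) :=
    (Measurable.lintegral_kernel_prod_right hf).comp measurable_fst
  have key : ∀ {k : Info (Unit ⊕ ℝ) EReal n → ℝ → ℝ≥0∞}, Measurable (Function.uncurry k) →
      ∫⁻ ω, k (ω.info n) ω.1 ∂(gaussianProblem.law σ)
        = ∫⁻ ω, ∫⁻ θ, ∫⁻ s, k (ω.hist n, s) θ ∂(gaussianObs n (θ, ω.hist n))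
            ∂(interimKernel n (ω.hist n)) ∂(gaussianProblem.law σ) := fun {k} hk => by
    rw [gaussianProblem.lintegral_law_info σ n (f := fun θ i => k i θ) (hk.comp measurable_swap),
      ← hinterim _ (hobs hk)]
    rfl
  rw [key hf, key hf2]
  exact lintegral_congr fun ω => lintegral_interimKernel n _
    (f := fun s θ => f (ω.hist n, s) θ)
    (hf.comp (f := fun p : (Unit ⊕ ℝ) × ℝ => ((ω.hist n, p.1), p.2)) (by fun_prop))

theorem lintegral_law_interim (σ : DecisionRule (Unit ⊕ ℝ) EReal) (n : ℕ)
    (g : (Fin n → (Unit ⊕ ℝ) × EReal) → ℝ → ℝ≥0∞) (hg : Measurable (Function.uncurry g)) :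
    ∫⁻ ω, g (ω.hist n) ω.1 ∂(gaussianProblem.law σ)
      = ∫⁻ ω, ∫⁻ θ, g (ω.hist n) θ ∂(interimKernel n (ω.hist n)) ∂(gaussianProblem.law σ) := by
  induction n with
  | zero =>
    have hg0 : Measurable fun θ => g (fun i => i.elim0) θ := hg.comp measurable_prodMk_left
    have h0 : ∀ ω : Play ℝ (Unit ⊕ ℝ) EReal, ω.hist 0 = fun i => i.elim0 :=
      fun ω => Subsingleton.elim _ _
    simp_rw [h0]
    rw [gaussianProblem.lintegral_law_param σ hg0, lintegral_const, measure_univ, mul_one]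
    rfl
  | succ n ih =>
    -- The action of stage `n` is a function of the information, and thus tells nothing new.
    have hact : ∀ᵐ ω ∂(gaussianProblem.law σ),
        ω.hist (n + 1) = addAction (ω.info n) (σ.act n (ω.info n)) :=
      (gaussianProblem.ae_action_eq σ n).mono fun ω hω => by rw [← ω.addAction_info, hω]
    have hf : Measurable (Function.uncurry fun (i : Info (Unit ⊕ ℝ) EReal n) (θ : ℝ) =>
        g (addAction i (σ.act n i)) θ) :=
      hg.comp (((measurable_addAction n).comp (measurable_fst.prodMk
        ((σ.measurable_act n).comp measurable_fst))).prodMk measurable_snd)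
    have h1 := lintegral_law_posterior_of_interim σ n ih hf
    rw [lintegral_congr_ae (hact.mono fun ω hω => congrArg (fun h => g h ω.1) hω), h1]
    exact lintegral_congr_ae (hact.mono fun ω hω =>
      congrArg (fun h => ∫⁻ θ, g h θ ∂(postKernel n (ω.info n))) hω.symm)

/-- For every decision rule, `postKernel` is the conditional law of the parameter. -/
theorem map_law_eq_compProd (σ : DecisionRule (Unit ⊕ ℝ) EReal) (n : ℕ) :
    (gaussianProblem.law σ).map (fun ω => (ω.info n, ω.1))
      = (gaussianProblem.law σ).map (fun ω => ω.info n) ⊗ₘ postKernel n := by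
  refine Measure.ext_of_lintegral _ fun f hf => ?_
  rw [lintegral_map hf ((Play.measurable_info n).prodMk measurable_fst),
    Measure.lintegral_compProd hf,
    lintegral_map (Measurable.lintegral_kernel_prod_right' hf) (Play.measurable_info n)]
  exact lintegral_law_posterior_of_interim σ n (lintegral_law_interim σ n)
    (f := fun i θ => f (i, θ)) hf

/-- The expected reward of an action, given what is known at stage `n`. -/
theorem integral_cos_postKernel (n : ℕ) (i : Info (Unit ⊕ ℝ) EReal n) (a : EReal) :
    ∫ θ, Real.cos (θ - angle a) ∂(postKernel n i)
      = value (numObs n i.1) * Real.cos (postMean n i - angle a) := by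
  rw [postKernel_apply, integral_cos_sub_gaussianReal, exp_neg_postVar]

/-- The expected reward of stage `n` under an arbitrary decision rule. -/
theorem integral_reward_law (σ : DecisionRule (Unit ⊕ ℝ) EReal) (n : ℕ) :
    ∫ ω, Real.cos (ω.1 - angle (ω.2 n).2) ∂(gaussianProblem.law σ)
      = ∫ ω, value (numObs n (ω.hist n)) * Real.cos (postMean n (ω.info n) - angle (ω.2 n).2)
          ∂(gaussianProblem.law σ) := by
  have hm : Measurable fun p : Info (Unit ⊕ ℝ) EReal n × ℝ =>
      Real.cos (p.2 - angle (σ.act n p.1)) :=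
    Real.measurable_cos.comp (measurable_snd.sub
      (continuous_angle.measurable.comp ((σ.measurable_act n).comp measurable_fst)))
  have hi : Measurable fun ω : Play ℝ (Unit ⊕ ℝ) EReal => (ω.info n, ω.1) :=
    (Play.measurable_info n).prodMk measurable_fst
  have hact := gaussianProblem.ae_action_eq σ n
  have : IsProbabilityMeasure ((gaussianProblem.law σ).map fun ω => ω.info n) :=
    Measure.isProbabilityMeasure_map (Play.measurable_info n).aemeasurable
  calc ∫ ω, Real.cos (ω.1 - angle (ω.2 n).2) ∂(gaussianProblem.law σ)
      = ∫ ω, Real.cos (ω.1 - angle (σ.act n (ω.info n))) ∂(gaussianProblem.law σ) :=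
        integral_congr_ae (hact.mono fun ω hω => by simp only [hω])
    _ = ∫ p, Real.cos (p.2 - angle (σ.act n p.1))
          ∂((gaussianProblem.law σ).map fun ω => (ω.info n, ω.1)) :=
        (integral_map hi.aemeasurable hm.aestronglyMeasurable).symm
    _ = ∫ i, ∫ θ, Real.cos (θ - angle (σ.act n i)) ∂(postKernel n i)
          ∂((gaussianProblem.law σ).map fun ω => ω.info n) := by
        rw [map_law_eq_compProd, Measure.integral_compProd]
        exact Integrable.of_bound hm.aestronglyMeasurable 1
          (ae_of_all _ fun p => Real.abs_cos_le_one _)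
    _ = ∫ i, value (numObs n i.1) * Real.cos (postMean n i - angle (σ.act n i))
          ∂((gaussianProblem.law σ).map fun ω => ω.info n) := by
        simp_rw [integral_cos_postKernel]
    _ = ∫ ω, value (numObs n (ω.hist n)) *
          Real.cos (postMean n (ω.info n) - angle (σ.act n (ω.info n)))
          ∂(gaussianProblem.law σ) := by
        refine integral_map (Play.measurable_info n).aemeasurable
          (Measurable.aestronglyMeasurable ?_)
        exact ((measurable_of_countable value).comp ((measurable_numObs n).comp measurable_fst)).mul
          (Real.measurable_cos.comp ((measurable_postMean n).sub
            (continuous_angle.measurable.comp (σ.measurable_act n))))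
    _ = _ := integral_congr_ae (hact.mono fun ω hω => by simp only [hω])

/-! ### Optimality -/

theorem follows_hist_iff (ω : Play ℝ (Unit ⊕ ℝ) EReal) :
    (∀ n, prescribed.Follows (ω.hist n)) ↔ ∀ n, (ω.2 n).2 = prescribed.act n (ω.info n) :=
  ⟨fun h n => h (n + 1) (Fin.last n), fun h _ k => h k⟩

open Classical in
/-- An upper bound of the expected reward of stage `n`: experimentation costs `cost n`, and the
highest expected reward depends on the number of observations. -/
def rewardBound (n : ℕ) (ω : Play ℝ (Unit ⊕ ℝ) EReal) : ℝ :=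
  if prescribed.Follows (ω.hist (n + 1)) then value n - cost n else value (numObs n (ω.hist n))

theorem measurable_rewardBound (n : ℕ) : Measurable (rewardBound n) :=
  Measurable.ite (Play.measurable_hist (n + 1) (prescribed.measurableSet_follows (n + 1)))
    measurable_const ((measurable_of_countable value).comp
      ((measurable_numObs n).comp (Play.measurable_hist n)))

theorem abs_rewardBound_le (n : ℕ) (ω : Play ℝ (Unit ⊕ ℝ) EReal) : |rewardBound n ω| ≤ 1 := by
  unfold rewardBound
  split_ifs
  · exact abs_value_sub_cost_le n
  · rw [abs_of_pos (value_pos _)]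
    linarith [value_lt_half (numObs n (ω.hist n))]

theorem value_mul_cos_of_follows {n : ℕ} {ω : Play ℝ (Unit ⊕ ℝ) EReal}
    (h : prescribed.Follows (ω.hist (n + 1))) :
    value (numObs n (ω.hist n)) * Real.cos (postMean n (ω.info n) - angle (ω.2 n).2)
      = value n - cost n := by
  obtain ⟨h1, h2⟩ := (prescribed.follows_succ_iff _).1 h
  have h3 : (ω.2 n).2 = ofAngle (postMean n (ω.info n) + tilt n) := h2
  have h4 : numObs n (ω.hist n) = n := numObs_of_follows h1
  rw [h3, h4, cos_sub_angle_ofAngle, ← value_mul_cos_tilt, sub_add_cancel_left, Real.cos_neg]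

theorem value_mul_cos_le_rewardBound (n : ℕ) (ω : Play ℝ (Unit ⊕ ℝ) EReal) :
    value (numObs n (ω.hist n)) * Real.cos (postMean n (ω.info n) - angle (ω.2 n).2)
      ≤ rewardBound n ω := by
  unfold rewardBound
  split_ifs with h
  · exact (value_mul_cos_of_follows h).le
  · exact mul_le_of_le_one_right (value_pos _).le (Real.cos_le_one _)

/-- A play that deviates from the prescribed actions is worth less than one that does not. -/
theorem discounted_rewardBound_lt {δ : ℝ} (hδ : 2 / 3 < δ) (hδ1 : δ < 1)
    {ω : Play ℝ (Unit ⊕ ℝ) EReal} (hω : ¬ ∀ n, prescribed.Follows (ω.hist n)) :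
    ∑' n, δ ^ n * rewardBound n ω < ∑' n, δ ^ n * (value n - cost n) := by
  push Not at hω
  -- `k` is the stage of the first deviation.
  obtain ⟨k, hk, hk'⟩ : ∃ k, prescribed.Follows (ω.hist k) ∧
      ¬ prescribed.Follows (ω.hist (k + 1)) := by
    by_contra! hne
    obtain ⟨n, hn⟩ := hω
    exact hn (Nat.rec (prescribed.follows_zero _) hne n)
  have hmono : ∀ {m n : ℕ}, m ≤ n → prescribed.Follows (ω.hist n) →
      prescribed.Follows (ω.hist m) := fun hmn h j => h (Fin.castLE hmn j)
  refine discounted_stop_lt hδ hδ1 k (fun n hn => ?_) fun n hn => ?_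
  · exact if_pos (hmono (Nat.succ_le_of_lt hn) hk)
  · have hnum : numObs n (ω.hist n) = k := by
      induction n, hn using Nat.le_induction with
      | base => exact numObs_of_follows hk
      | succ n hn ih =>
        have : ¬ prescribed.Follows (ω.hist (n + 1)) :=
          fun h => hk' (hmono (Nat.succ_le_succ hn) h)
        exact (if_neg this).trans ih
    have h1 : ¬ prescribed.Follows (ω.hist (n + 1)) :=
      fun h => hk' (hmono (Nat.succ_le_succ hn) h)
    rw [rewardBound, if_neg h1, hnum]

theorem discounted_rewardBound_of_follows {δ : ℝ} {ω : Play ℝ (Unit ⊕ ℝ) EReal}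
    (hω : ∀ n, prescribed.Follows (ω.hist n)) :
    ∑' n, δ ^ n * rewardBound n ω = ∑' n, δ ^ n * (value n - cost n) :=
  tsum_congr fun n => by rw [rewardBound, if_pos (hω (n + 1))]

theorem ae_follows :
    ∀ᵐ ω ∂(gaussianProblem.law prescribed), ∀ n, prescribed.Follows (ω.hist n) := by
  filter_upwards [ae_all_iff.2 (gaussianProblem.ae_action_eq prescribed)] with ω hω
  exact (follows_hist_iff ω).2 hω

theorem payoff_gaussianProblem {δ : ℝ} (hδ0 : 0 ≤ δ) (hδ1 : δ < 1)
    (σ : DecisionRule (Unit ⊕ ℝ) EReal) :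
    gaussianProblem.payoff δ σ = (1 - δ) * ∑' n, δ ^ n *
      ∫ ω, value (numObs n (ω.hist n)) * Real.cos (postMean n (ω.info n) - angle (ω.2 n).2)
        ∂(gaussianProblem.law σ) := by
  have hX : ∀ n, Measurable fun ω : Play ℝ (Unit ⊕ ℝ) EReal =>
      Real.cos (ω.1 - angle (ω.2 n).2) := fun n =>
    Real.measurable_cos.comp (measurable_fst.sub
      (continuous_angle.measurable.comp (Play.measurable_action n)))
  simp_rw [← integral_reward_law]
  rw [← integral_discounted hX (fun n ω => Real.abs_cos_le_one _) hδ0 hδ1, ← integral_const_mul]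
  rfl

theorem payoff_prescribed {δ : ℝ} (hδ0 : 0 ≤ δ) (hδ1 : δ < 1) :
    gaussianProblem.payoff δ prescribed = (1 - δ) * ∑' n, δ ^ n * (value n - cost n) := by
  rw [payoff_gaussianProblem hδ0 hδ1]
  congr 2
  funext n
  rw [integral_congr_ae (ae_follows.mono fun ω hω => value_mul_cos_of_follows (hω (n + 1)))]
  simp

theorem payoff_le_integral_rewardBound {δ : ℝ} (hδ0 : 0 ≤ δ) (hδ1 : δ < 1)
    (σ : DecisionRule (Unit ⊕ ℝ) EReal) :
    gaussianProblem.payoff δ σ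
      ≤ (1 - δ) * ∫ ω, ∑' n, δ ^ n * rewardBound n ω ∂(gaussianProblem.law σ) := by
  have hbound : ∀ (n : ℕ) (ω : Play ℝ (Unit ⊕ ℝ) EReal), |value (numObs n (ω.hist n))
      * Real.cos (postMean n (ω.info n) - angle (ω.2 n).2)| ≤ 1 := fun n ω => by
    rw [abs_mul, abs_of_pos (value_pos _)]
    exact mul_le_one₀ (by linarith [value_lt_half (numObs n (ω.hist n))]) (abs_nonneg _)
      (Real.abs_cos_le_one _)
  have hmeas : ∀ n, Measurable fun ω : Play ℝ (Unit ⊕ ℝ) EReal => value (numObs n (ω.hist n))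
      * Real.cos (postMean n (ω.info n) - angle (ω.2 n).2) := fun n =>
    ((measurable_of_countable value).comp ((measurable_numObs n).comp (Play.measurable_hist n))).mul
      (Real.measurable_cos.comp (((measurable_postMean n).comp (Play.measurable_info n)).sub
        (continuous_angle.measurable.comp (Play.measurable_action n))))
  have hle1 : ∀ {X : Play ℝ (Unit ⊕ ℝ) EReal → ℝ}, (∀ ω, |X ω| ≤ 1) →
      |∫ ω, X ω ∂(gaussianProblem.law σ)| ≤ 1 := fun {X} hX => by
    simpa using norm_integral_le_of_norm_le_const (μ := gaussianProblem.law σ) (f := X) (C := 1)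
      (ae_of_all _ hX)
  rw [payoff_gaussianProblem hδ0 hδ1, integral_discounted measurable_rewardBound abs_rewardBound_le
    hδ0 hδ1]
  refine mul_le_mul_of_nonneg_left ?_ (by linarith)
  refine (summable_discounted hδ0 hδ1 fun n => hle1 (hbound n)).tsum_le_tsum (fun n => ?_)
    (summable_discounted hδ0 hδ1 fun n => hle1 (abs_rewardBound_le n))
  refine mul_le_mul_of_nonneg_left (integral_mono ?_ ?_ (value_mul_cos_le_rewardBound n))
    (pow_nonneg hδ0 n)
  · exact Integrable.of_bound (hmeas n).aestronglyMeasurable 1 (ae_of_all _ (hbound n))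
  · exact Integrable.of_bound (measurable_rewardBound n).aestronglyMeasurable 1
      (ae_of_all _ (abs_rewardBound_le n))

theorem integrable_discounted_rewardBound {δ : ℝ} (hδ0 : 0 ≤ δ) (hδ1 : δ < 1)
    (σ : DecisionRule (Unit ⊕ ℝ) EReal) :
    Integrable (fun ω => ∑' n, δ ^ n * rewardBound n ω) (gaussianProblem.law σ) := by
  have hs : ∀ ω, Summable fun n => δ ^ n * rewardBound n ω := fun ω =>
    summable_discounted hδ0 hδ1 fun n => abs_rewardBound_le n ω
  have hm : Measurable fun ω => ∑' n, δ ^ n * rewardBound n ω :=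
    measurable_of_tendsto_metrizable
      (f := fun N ω => ∑ n ∈ Finset.range N, δ ^ n * rewardBound n ω)
      (fun N => Finset.measurable_sum _ fun n _ => (measurable_rewardBound n).const_mul _)
      (tendsto_pi_nhds.2 fun ω => (hs ω).hasSum.tendsto_sum_nat)
  refine Integrable.of_bound hm.aestronglyMeasurable (∑' n, δ ^ n) (ae_of_all _ fun ω => ?_)
  have hgeom := summable_geometric_of_lt_one hδ0 hδ1
  refine tsum_of_norm_bounded hgeom.hasSum fun n => ?_
  rw [norm_mul, norm_pow, Real.norm_eq_abs, abs_of_nonneg hδ0]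
  exact mul_le_of_le_one_right (pow_nonneg hδ0 n) (abs_rewardBound_le n ω)

theorem discounted_rewardBound_le {δ : ℝ} (hδ : 2 / 3 < δ) (hδ1 : δ < 1)
    (ω : Play ℝ (Unit ⊕ ℝ) EReal) :
    ∑' n, δ ^ n * rewardBound n ω ≤ ∑' n, δ ^ n * (value n - cost n) := by
  by_cases hω : ∀ n, prescribed.Follows (ω.hist n)
  · exact (discounted_rewardBound_of_follows hω).le
  · exact (discounted_rewardBound_lt hδ hδ1 hω).le

theorem isOptimal_prescribed {δ : ℝ} (hδ : 2 / 3 < δ) (hδ1 : δ < 1) :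
    gaussianProblem.IsOptimal δ prescribed := by
  intro τ
  have hδ0 : 0 ≤ δ := by linarith
  rw [payoff_prescribed hδ0 hδ1]
  refine (payoff_le_integral_rewardBound hδ0 hδ1 τ).trans
    (mul_le_mul_of_nonneg_left ?_ (by linarith))
  refine (integral_mono (integrable_discounted_rewardBound hδ0 hδ1 τ) (integrable_const _)
    (discounted_rewardBound_le hδ hδ1)).trans_eq ?_
  simp

theorem playsAs_prescribed_of_isOptimal {δ : ℝ} (hδ : 2 / 3 < δ) (hδ1 : δ < 1)
    {τ : DecisionRule (Unit ⊕ ℝ) EReal} (hτ : gaussianProblem.IsOptimal δ τ) :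
    gaussianProblem.PlaysAs τ prescribed := by
  have hδ0 : 0 ≤ δ := by linarith
  have h1 := (hτ prescribed).trans (payoff_le_integral_rewardBound hδ0 hδ1 τ)
  rw [payoff_prescribed hδ0 hδ1] at h1
  have h2 := le_of_mul_le_mul_left h1 (by linarith)
  have hint := integrable_discounted_rewardBound hδ0 hδ1 τ
  -- The loss from deviations is nonnegative, with a nonpositive expectation.
  have h3 : ∫ ω, (∑' n, δ ^ n * (value n - cost n) - ∑' n, δ ^ n * rewardBound n ω)
      ∂(gaussianProblem.law τ) = 0 := by
    refine le_antisymm ?_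
      (integral_nonneg fun ω => sub_nonneg.2 (discounted_rewardBound_le hδ hδ1 ω))
    rw [integral_sub (integrable_const _) hint]
    simpa using h2
  rw [integral_eq_zero_iff_of_nonneg
    (fun ω => sub_nonneg.2 (discounted_rewardBound_le hδ hδ1 ω))
    ((integrable_const _).sub hint)] at h3
  refine gaussianProblem.playsAs_of_ae_action_eq (ae_all_iff.1 ?_)
  filter_upwards [h3] with ω hω
  refine (follows_hist_iff ω).1 ?_
  by_contra hne
  exact (sub_pos.2 (discounted_rewardBound_lt hδ hδ1 hne)).ne' hω

/-! ### The amount of experimentation -/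

/-- When the prescribed actions are followed, the amount of experimentation is deterministic. -/
theorem ae_experimentation_eq (n : ℕ) :
    ∀ᵐ ω ∂(gaussianProblem.law prescribed),
      gaussianProblem.experimentation prescribed n ω = cost n := by
  have hpost := condDistrib_ae_eq_of_measure_eq_compProd (μ := gaussianProblem.law prescribed)
    (fun ω => ω.info n) measurable_fst.aemeasurable (map_law_eq_compProd prescribed n)
  filter_upwards [ae_of_ae_map (Play.measurable_info n).aemeasurable hpost, ae_follows] with ω h1 h2
  have hexp : ∀ a, gaussianProblem.expReward prescribed n ω a
      = value (numObs n (ω.hist n)) * Real.cos (postMean n (ω.info n) - angle a) := fun a => by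
    rw [DecisionProblem.expReward, DecisionProblem.posterior, h1]
    exact integral_cos_postKernel n (ω.info n) a
  rw [DecisionProblem.experimentation]
  simp_rw [hexp]
  rw [iSup_cos_sub_angle _ (value_pos _).le, value_mul_cos_of_follows (h2 (n + 1)),
    numObs_of_follows (h2 n)]
  ring

theorem expectedNumExperiments_prescribed (ε : ℝ) :
    gaussianProblem.expectedNumExperiments prescribed ε
      = (({n | ε ≤ cost n}.encard : ℕ∞) : ℝ≥0∞) := by
  have h : ∀ᵐ ω ∂(gaussianProblem.law prescribed),
      (gaussianProblem.numExperiments prescribed ε ω : ℝ≥0∞)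
        = (({n | ε ≤ cost n}.encard : ℕ∞) : ℝ≥0∞) := by
    filter_upwards [ae_all_iff.2 ae_experimentation_eq] with ω hω
    simp only [DecisionProblem.numExperiments, hω]
  rw [DecisionProblem.expectedNumExperiments, lintegral_congr_ae h]
  simp

end

theorem proposition3 :
    ∃ (D : DecisionProblem ℝ (Unit ⊕ ℝ) EReal) (a : DecisionRule (Unit ⊕ ℝ) EReal)
      (v : ℕ → ℝ≥0),
      IsGaussianProblem D a v ∧
      (∀ n, ∀ᵐ ω ∂(D.law a), 0 < D.experimentation a n ω) ∧
      ∀ δ : ℝ, 2 / 3 < δ → δ < 1 →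
        ∃ σ : DecisionRule (Unit ⊕ ℝ) EReal,
          D.IsOptimal δ σ ∧
          (∀ τ : DecisionRule (Unit ⊕ ℝ) EReal, D.IsOptimal δ τ → D.PlaysAs τ σ) ∧
          ∀ α : ℝ, α < 1 →
            Tendsto (fun ε : ℝ => ENNReal.ofReal (ε ^ α) * D.expectedNumExperiments σ ε)
              (𝓝[>] 0) (𝓝 ⊤) := by
  refine ⟨gaussianProblem, prescribed, noise, isGaussianProblem_gaussianProblem, fun n => ?_,
    fun δ hδ hδ1 => ⟨prescribed, isOptimal_prescribed hδ hδ1,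
      fun τ hτ => playsAs_prescribed_of_isOptimal hδ hδ1 hτ, fun α hα => ?_⟩⟩
  · exact (ae_experimentation_eq n).mono fun ω hω => hω ▸ cost_pos n
  · simp_rw [expectedNumExperiments_prescribed]
    exact tendsto_rpow_mul_encard_cost hα
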